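/- Let $k\ge 1$ be an integer, $N>1$, and let $c_0,C_0,C_S,K,R>0$. Then there are constants $C_1,C_2>0$, depending only on $k,N,c_0,C_0,C_S,K,R$, such that the following holds. **Setting.** Let $\Omega\subset\mathbb R^n$ be open and bounded, let $d$ be a metric on $\Omega$ whose balls $B(x,\rho)=\{y\in\Omega: d(x,y)<\rho\}$ are Lebesgue measurable, and let $w\ge 0$ be measurable; write $d\mu=w\,dx$ and $w(U)=\int_U w\,dx$. Let $A$ be a measurable, bounded, symmetric nonnegative semidefinite $n\times n$ matrix function on $\Omega$ with $|A(x)\xi|\le\Lambda w(x)|\xi|$ for some $\Lambda>0$, and let $S$ be a Lipschitz matrix function with $c_0\,\xi^{\rm tr}A\xi\le|S\xi|^2\le C_0\,\xi^{\rm tr}A\xi$ for a.e. $x\in\Omega$ and all $\xi\in\mathbb R^n$; put $\nabla_A=S\nabla$. Let $W_A^{1,2}(\Omega)$ be the completion of the locally Lipschitz functions on $\Omega$ of finite norm $(\int_\Omega |v|^2+\nabla v^{\rm tr}A\nabla v\,dx)^{1/2}$, and $(W_A^{1,2})_0(U)$ the closure of $\mathrm{Lip}_c(U)$, the Lipschitz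 functions with compact support in $U$, in the corresponding norm over $U$. Let $\varphi$ be nondecreasing on $[0,R]$ with $\varphi(0)=0$ and $\varphi(\rho)\ge\rho$. Let $\phi$ be measurable and let $u\in W_A^{1,2}(\Omega)$ be a weak subsolution of $Lu=\nabla^{\rm tr}A\nabla u=\phi$ in $\Omega$, i.e. $-\int_\Omega\nabla g^{\rm tr}A\nabla u\ge\int_\Omega\phi g$ for all nonnegative $g\in(W_A^{1,2})_0(\Omega)$ with $\phi g$ integrable. **Notation.** $f^{(j)}$ is the $j$-fold composition of $f$, and $E=\exp^{(k)}(2N)$. Let $\Phi_{k,N}(t)=t^2\,h(\max(t^2,E))$, where $h(s)=(\ln s)^2(\ln\ln s)^2\cdots(\ln^{(k-1)}s)^2(\ln^{(k)}s)^{2N}$. Let $\kappa(j)=j^2$ for integers $1\le j\le E$ and $\kappa(j)=j\ln j\cdots\ln^{(k-2)}j\,(\ln^{(k-1)}j)^{(N+1)/2}$ for $j>E$ (so $\kappa(j)=j^{(N+1)/2}$ there if $k=1$). For a ball $U$, $$\|\phi\|_{X(U)}=\sup_{v\in(W_A^{1,2})_0(U)}w(\{y\in U:v(y)\ne0\})^{-1/2}\,\frac{\left|\int_Uv\phi\,dx\right|}{\|\nabla_Av\|_{L^2(U)}},$$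 with $0/0=0$ and $c/0=\infty$ for $c>0$; $\phi$ is $A$-admissible on $U$ if $v\phi$ is integrable on $U$ for every such $v$ and $\|\phi\|_{X(U)}<\infty$. **Hypotheses on the ball.** Let $x\in\Omega$, $0<r\le R/3$, $B=B(x,r)$, $\tfrac12B=B(x,r/2)$, $3B=B(x,3r)$, with $w(3B)<\infty$. Assume: 1. (Orlicz–Sobolev inequality on $3B$) for all $v\in\mathrm{Lip}_c(3B)$, $$\|v\|_{L^{\Phi_{k,N}}(\mu_{3B})}\le C_S\,\frac{\varphi(3r)}{w(3B)^{1/2}}\,\|\nabla_Av\|_{L^2},\qquad d\mu_{3B}=\frac{w\,dx}{w(3B)}\ \text{on }3B,$$ where $\|v\|_{L^\Phi(\nu)}=\inf\{a>0:\int\Phi(|v|/a)\,d\nu\le1\}$; 2. (adapted cutoff functions at $(x,r)$) there are radii with $r_1=r$, $r_j\to r/2$ and $r_j-r_{j+1}=cr/\kappa(j)$ for some $c>0$, and Lipschitz functions $\psi_j$, $j\ge 1$, with compact support in $B(x,r_j)$, $\psi_j=1$ on $B(x,r_{j+1})$ and $|\nabla_A\psi_j|\le K\frac{\kappa(j)}{r}w^{1/2}$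 a.e. in $\Omega$; 3. $\phi$ is $A$-admissible on $B$. **Conclusion.** $$\|u_+\|_{L^\infty_w(\frac12B)}\le A_{k,N}(3r)\left(\frac1{w(3B)}\int_Bu_+^2\,w\,dx\right)^{1/2}+\|\phi\|_{X(B)},$$ where $$A_{k,N}(\rho)=C_1\left[\exp^{(k)}\!\left(C_2\left(\frac{\varphi(\rho)}{\rho}\right)^{\frac2{N-1}}\right)\right]^{1/2}.$$ Here $L^\infty_w$ is the essential supremum with respect to $w\,dx$ (the usual one if $w>0$ a.e.), and the right-hand side may be $+\infty$. -/

import Mathlib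

open MeasureTheory Filter Topology
open scoped ENNReal NNReal

noncomputable section

namespace DegEll

/-- Euclidean space `ℝⁿ`. -/
abbrev Eucl (n : ℕ) : Type := EuclideanSpace ℝ (Fin n)

/-! ### Young functions and the sequence of radii -/

/-- The threshold `E_{k,N} = exp^{(k)}(2N)`. -/
def threshold (k : ℕ) (N : ℝ) : ℝ := Real.exp^[k] (2 * N)

/-- `(ln s)² (ln ln s)² ⋯ (ln^{(k-1)} s)² (ln^{(k)} s)^{2N}`. -/
def logFactor (k : ℕ) (N s : ℝ) : ℝ :=
  (∏ i ∈ Finset.Icc 1 (k - 1), (Real.log^[i] s) ^ 2) * (Real.log^[k] s) ^ (2 * N)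

/-- The Young function `Φ_{k,N}`. -/
def youngPhi (k : ℕ) (N t : ℝ) : ℝ :=
  if threshold k N ≤ t ^ 2 then t ^ 2 * logFactor k N (t ^ 2)
  else t ^ 2 * logFactor k N (threshold k N)

/-- `κ_{k,N}(j)`: equal to `j²` for `j ≤ E_{k,N}` and to
`j ln j ⋯ ln^{(k-2)} j (ln^{(k-1)} j)^{(N+1)/2}` for `j > E_{k,N}`. -/
def kappa (k : ℕ) (N : ℝ) (j : ℕ) : ℝ :=
  if (j : ℝ) ≤ threshold k N then (j : ℝ) ^ 2
  else (∏ i ∈ Finset.range (k - 1), Real.log^[i] (j : ℝ)) *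
    (Real.log^[k - 1] (j : ℝ)) ^ ((N + 1) / 2)

/-- The radii `r = r₁ > r₂ > ⋯ → r / 2` with `r_j - r_{j+1} = c r / κ_{k,N}(j)`; the term `ρ 0`
plays no role. -/
structure IsAdaptedRadii (k : ℕ) (N r : ℝ) (ρ : ℕ → ℝ) : Prop where
  first : ρ 1 = r
  step : ∃ c : ℝ, 0 < c ∧ ∀ j : ℕ, 1 ≤ j → ρ j - ρ (j + 1) = c * r / kappa k N j
  limit : Tendsto ρ atTop (𝓝 (r / 2))

/-- The factor `C₁ [exp^{(k)} (C₂ (φ(ρ)/ρ)^{2/(N-1)})]^{1/2}`. -/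
def growthFactor (k : ℕ) (N C₁ C₂ : ℝ) (φ : ℝ → ℝ) (ρ : ℝ) : ℝ :=
  C₁ * (Real.exp^[k] (C₂ * (φ ρ / ρ) ^ (2 / (N - 1)))) ^ (1 / 2 : ℝ)

/-- The Luxemburg norm `inf {a > 0 : ∫ Φ(|f| / a) dν ≤ 1}`, equal to `∞` if there is no such `a`. -/
def luxemburgNorm {α : Type*} [MeasurableSpace α] (Φ : ℝ → ℝ) (ν : Measure α) (f : α → ℝ) :
    ℝ≥0∞ :=
  ⨅ (a : ℝ≥0) (_ : 0 < a) (_ : ∫⁻ x, ENNReal.ofReal (Φ (|f x| / a)) ∂ν ≤ 1), (a : ℝ≥0∞)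

/-! ### Metric, weight, coefficients -/

variable {n : ℕ}

/-- `d` is a metric on the set `Ω`. -/
structure IsMetricOn (d : Eucl n → Eucl n → ℝ) (Ω : Set (Eucl n)) : Prop where
  nonneg : ∀ x ∈ Ω, ∀ y ∈ Ω, 0 ≤ d x y
  eq_zero_iff : ∀ x ∈ Ω, ∀ y ∈ Ω, d x y = 0 ↔ x = y
  symm : ∀ x ∈ Ω, ∀ y ∈ Ω, d x y = d y x
  triangle : ∀ x ∈ Ω, ∀ y ∈ Ω, ∀ z ∈ Ω, d x z ≤ d x y + d y z

/-- The metric ball `B(x, r)` of `(Ω, d)`. -/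
def dball (d : Eucl n → Eucl n → ℝ) (Ω : Set (Eucl n)) (x : Eucl n) (r : ℝ) : Set (Eucl n) :=
  {y | y ∈ Ω ∧ d x y < r}

/-- The measure `dμ = w dx`. -/
def wMeasure (w : Eucl n → ℝ≥0) : Measure (Eucl n) :=
  volume.withDensity fun x => (w x : ℝ≥0∞)

/-- The matrix-vector product as a map of Euclidean spaces. -/
def mulE (M : Matrix (Fin n) (Fin n) ℝ) (ξ : Eucl n) : Eucl n :=
  WithLp.toLp 2 (M.mulVec ξ.ofLp)

/-- The standing assumptions on the matrix `A`, the weight `w` and the Lipschitz matrix `S`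
(with `∇_A = S ∇`): `A` is symmetric, nonnegative semidefinite, measurable, bounded,
`|A ξ| ≤ Λ w |ξ|`, and `c₀ ξᵗ A ξ ≤ |S ξ|² ≤ C₀ ξᵗ A ξ`. -/
structure IsCoefficient (Ω : Set (Eucl n)) (w : Eucl n → ℝ≥0)
    (A S : Eucl n → Matrix (Fin n) (Fin n) ℝ) (c₀ C₀ : ℝ) : Prop where
  measurable : ∀ i j, AEMeasurable (fun x => A x i j) (volume.restrict Ω)
  posSemidef : ∀ᵐ x ∂volume.restrict Ω, (A x).PosSemidef
  bounded : ∃ M : ℝ, ∀ᵐ x ∂volume.restrict Ω, ∀ i j, |A x i j| ≤ M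
  le_weight : ∃ Λ : ℝ, 0 < Λ ∧
    ∀ᵐ x ∂volume.restrict Ω, ∀ ξ : Eucl n, ‖mulE (A x) ξ‖ ≤ Λ * w x * ‖ξ‖
  lipschitz : ∀ i j, ∃ L : ℝ≥0, LipschitzOnWith L (fun x => S x i j) Ω
  lower : ∀ᵐ x ∂volume.restrict Ω, ∀ ξ : Eucl n,
    c₀ * inner ℝ ξ (mulE (A x) ξ) ≤ ‖mulE (S x) ξ‖ ^ 2
  upper : ∀ᵐ x ∂volume.restrict Ω, ∀ ξ : Eucl n,
    ‖mulE (S x) ξ‖ ^ 2 ≤ C₀ * inner ℝ ξ (mulE (A x) ξ)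

/-! ### Degenerate Sobolev spaces -/

/-- `Lip_c(U)`: Lipschitz functions with compact support contained in `U`. -/
def LipC (U : Set (Eucl n)) (v : Eucl n → ℝ) : Prop :=
  (∃ L : ℝ≥0, LipschitzWith L v) ∧ HasCompactSupport v ∧ tsupport v ⊆ U

/-- The energy `∫_U Gᵗ A G` of a vector field. -/
def energy (A : Eucl n → Matrix (Fin n) (Fin n) ℝ) (U : Set (Eucl n)) (G : Eucl n → Eucl n) :
    ℝ≥0∞ :=
  ∫⁻ x in U, ENNReal.ofReal (inner ℝ (G x) (mulE (A x) (G x)))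

/-- `‖S G‖_{L²(U)}`; for `G = ∇ v` this is `‖∇_A v‖_{L²(U)}`. -/
def gradNorm (S : Eucl n → Matrix (Fin n) (Fin n) ℝ) (U : Set (Eucl n)) (G : Eucl n → Eucl n) :
    ℝ≥0∞ :=
  (∫⁻ x in U, ENNReal.ofReal (‖mulE (S x) (G x)‖ ^ 2)) ^ (1 / 2 : ℝ)

/-- The functions `v_j` converge to `v` in the norm `(∫_U |v|² + ∇vᵗ A ∇v)^{1/2}`, where the
gradient of the limit is represented by the vector field `G`. -/
structure SobolevLimit (A : Eucl n → Matrix (Fin n) (Fin n) ℝ) (U : Set (Eucl n))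
    (vj : ℕ → Eucl n → ℝ) (v : Eucl n → ℝ) (G : Eucl n → Eucl n) : Prop where
  meas : AEStronglyMeasurable v (volume.restrict U)
  meas_grad : AEStronglyMeasurable G (volume.restrict U)
  tendsto : Tendsto (fun j => ∫⁻ x in U, ENNReal.ofReal ((vj j x - v x) ^ 2)) atTop (𝓝 0)
  tendsto_grad : Tendsto (fun j => energy A U fun x => gradient (vj j) x - G x) atTop (𝓝 0)

/-- `v ∈ W_A^{1,2}(Ω)` with gradient `G`: the space is the completion of the locally Lipschitz
functions on `Ω` of finite norm. -/
def MemWA (A : Eucl n → Matrix (Fin n) (Fin n) ℝ) (Ω : Set (Eucl n)) (v : Eucl n → ℝ)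
    (G : Eucl n → Eucl n) : Prop :=
  ∃ vj : ℕ → Eucl n → ℝ,
    (∀ j, LocallyLipschitzOn Ω (vj j) ∧ ∫⁻ x in Ω, ENNReal.ofReal (vj j x ^ 2) < ∞ ∧
      energy A Ω (gradient (vj j)) < ∞) ∧
    SobolevLimit A Ω vj v G

/-- `v ∈ (W_A^{1,2})₀(U)` with gradient `G`: the closure of `Lip_c(U)`. -/
def MemWAZero (A : Eucl n → Matrix (Fin n) (Fin n) ℝ) (U : Set (Eucl n)) (v : Eucl n → ℝ)
    (G : Eucl n → Eucl n) : Prop :=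
  ∃ vj : ℕ → Eucl n → ℝ, (∀ j, LipC U (vj j)) ∧ SobolevLimit A U vj v G

/-- `u ∈ W_A^{1,2}(Ω)` is a weak subsolution to `∇ᵗ A ∇ u = f` in `Ω`:
`-∫ ∇gᵗ A ∇u ≥ ∫ f g` for all nonnegative `g ∈ (W_A^{1,2})₀(Ω)` for which `∫ f g` makes sense. -/
def IsWeakSubsolution (A : Eucl n → Matrix (Fin n) (Fin n) ℝ) (Ω : Set (Eucl n))
    (f u : Eucl n → ℝ) : Prop :=
  ∃ Gu : Eucl n → Eucl n, MemWA A Ω u Gu ∧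
    ∀ (g : Eucl n → ℝ) (Gg : Eucl n → Eucl n), MemWAZero A Ω g Gg →
      (∀ᵐ x ∂volume.restrict Ω, 0 ≤ g x) → IntegrableOn (fun x => f x * g x) Ω →
      ∫ x in Ω, f x * g x ≤ -∫ x in Ω, inner ℝ (Gg x) (mulE (A x) (Gu x))

/-! ### Admissible right-hand sides, Orlicz–Sobolev inequality, cutoff functions -/

/-- `‖f‖_{X(U)}`, the supremum over `v ∈ (W_A^{1,2})₀(U)` of
`w({y ∈ U : v(y) ≠ 0})^{-1/2} |∫_U v f| / ‖∇_A v‖_{L²(U)}`, where `0 / 0 = 0`. -/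
def xNorm (w : Eucl n → ℝ≥0) (A S : Eucl n → Matrix (Fin n) (Fin n) ℝ) (U : Set (Eucl n))
    (f : Eucl n → ℝ) : ℝ≥0∞ :=
  ⨆ (v : Eucl n → ℝ) (G : Eucl n → Eucl n) (_ : MemWAZero A U v G),
    ENNReal.ofReal |∫ x in U, v x * f x| /
      (wMeasure w {y | y ∈ U ∧ v y ≠ 0} ^ (1 / 2 : ℝ) * gradNorm S U G)

/-- `f` is `A`-admissible on the ball `U`: the integrals in `‖f‖_{X(U)}` exist and
`‖f‖_{X(U)} < ∞`. -/
def IsAdmissibleOn (w : Eucl n → ℝ≥0) (A S : Eucl n → Matrix (Fin n) (Fin n) ℝ)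
    (U : Set (Eucl n)) (f : Eucl n → ℝ) : Prop :=
  (∀ (v : Eucl n → ℝ) (G : Eucl n → Eucl n), MemWAZero A U v G →
    IntegrableOn (fun x => v x * f x) U) ∧ xNorm w A S U f < ∞

/-- `φ` is a superradius on `[0, R]`. -/
structure IsSuperradius (φ : ℝ → ℝ) (R : ℝ) : Prop where
  mono : MonotoneOn φ (Set.Icc 0 R)
  zero : φ 0 = 0
  ge : ∀ r ∈ Set.Icc 0 R, r ≤ φ r

/-- The Orlicz–Sobolev inequality on the ball `U` of radius `ρ`: for all `v ∈ Lip_c(U)`,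
`‖v‖_{L^Φ(μ_U)} ≤ C φ(ρ) w(U)^{-1/2} ‖∇_A v‖_{L²}`, where `dμ_U = w dx / w(U)` on `U`. -/
def OrliczSobolevOn (Φ : ℝ → ℝ) (w : Eucl n → ℝ≥0) (S : Eucl n → Matrix (Fin n) (Fin n) ℝ)
    (U : Set (Eucl n)) (C : ℝ) (φ : ℝ → ℝ) (ρ : ℝ) : Prop :=
  ∀ v : Eucl n → ℝ, LipC U v →
    luxemburgNorm Φ ((wMeasure w U)⁻¹ • (wMeasure w).restrict U) v ≤
      ENNReal.ofReal (C * φ ρ) / wMeasure w U ^ (1 / 2 : ℝ) * gradNorm S U (gradient v)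

/-- There is an adapted sequence of Lipschitz cutoff functions at `(x, r)`, with constant `K`:
`supp ψ_j ⊆ B(x, r_j)`, `ψ_j = 1` on `B(x, r_{j+1})`, and
`|∇_A ψ_j| ≤ K κ_{k,N}(j) r⁻¹ w^{1/2}` almost everywhere. -/
def HasAdaptedCutoffs (k : ℕ) (N : ℝ) (d : Eucl n → Eucl n → ℝ) (Ω : Set (Eucl n))
    (w : Eucl n → ℝ≥0) (S : Eucl n → Matrix (Fin n) (Fin n) ℝ) (K : ℝ) (x : Eucl n) (r : ℝ) :
    Prop :=
  ∃ (ρ : ℕ → ℝ) (ψ : ℕ → Eucl n → ℝ), IsAdaptedRadii k N r ρ ∧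
    ∀ j : ℕ, 1 ≤ j → LipC (dball d Ω x (ρ j)) (ψ j) ∧
      (∀ y ∈ dball d Ω x (ρ (j + 1)), ψ j y = 1) ∧
      ∀ᵐ y ∂volume.restrict Ω,
        ‖mulE (S y) (gradient (ψ j) y)‖ ≤ K * (kappa k N j / r) * Real.sqrt (w y)

end DegEll

end

open DegEll

noncomputable section

namespace DegEll

/-! ### Iterated logarithms and the Young function -/

/-! The proof is a De Giorgi iteration whose gain is only logarithmic. Put `F = φ(3r)/(3r)`, `W =
w(3B)`, `p = k - 1` and `h = logFactor k N`. For a level `T`, let `z_i` be the integral of `(u -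
level_i T)₊²` against `w dx` over `B(x, ρ_{i+1})`, where consecutive levels differ by `1 / (σ
κ(i+1))` and stay below `1`. If `z_i → 0`, then `u ≤ T` on the half ball.

One step (`deGiorgi_step`) combines three estimates. Chebyshev bounds the weighted measure of the
next superlevel set by `z` over the squared gap. The Caccioppoli inequality (`caccioppoli`) bounds
the energy of the truncated function times a cutoff by a constant times `κ² z / r²`; here the
right-hand side of the equation is absorbed by `‖φ‖_X ≤ T`. The Orlicz–Sobolev inequality enters
through the pointwise bound `(t² - s) h(s) ≤ Φ(t)` for every `s ≥ E`: it gives an `L²` bound by `a²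
(s m + W / h(s))`, with `m` the measure of the support and `a² W` comparable to `φ(3r)²` times the
energy.

The parameter `s` is free and is taken to be `e^b` with `b = L + j` at step `j`. If `z ≤ T² W
e^{-4b}`, the small-support term is exponentially small, so the factor gained is about `F² κ(j)² /
h(e^b)`. The radii are tailored to `h`: by `logFactor_exp`, `h(e^b)` is the square of the product
defining `κ`, evaluated at `b`, times `(ln^{(p)} b)^{N-1}`. Hence the factor is at most `e^{-4}` as
soon as `(ln^{(p)} L)^{N-1}` exceeds a multiple of `F²`, that is, for `L = exp^{(p)}(C
F^{2/(N-1)})`. This is `exists_iteration_constant`. The starting condition `z_0 ≤ T² W e^{-4(L+1)}`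
then costs a factor `e^{2(L+1)}` in `T`, which is the growth factor in the theorem.

Gradients in the completed space are limits, and nothing forces them to vanish on a level set `{u =
C}`. Truncation is therefore carried out only at levels whose level set is null; all but countably
many `T` provide this for the whole sequence of levels. -/

theorem le_iterate_exp (z : ℝ) (i : ℕ) : z ≤ Real.exp^[i] z := by
  induction i with
  | zero => simp
  | succ i ih =>
    rw [Function.iterate_succ_apply']
    linarith [Real.add_one_le_exp (Real.exp^[i] z)]

theorem iterate_exp_mono (i : ℕ) : Monotone (Real.exp^[i]) :=
  Real.exp_monotone.iterate i

theorem le_iterate_log {z b : ℝ} {i : ℕ} (h : Real.exp^[i] z ≤ b) : z ≤ Real.log^[i] b := by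
  induction i generalizing b with
  | zero => simpa using h
  | succ i ih =>
    rw [Function.iterate_succ_apply'] at h
    rw [Function.iterate_succ_apply]
    exact ih ((Real.le_log_iff_exp_le (lt_of_lt_of_le (Real.exp_pos _) h)).2 h)

/-- The hypothesis `exp^[p] y ≤ b` with `y > 0` serves throughout as the domain condition: it keeps
all iterated logarithms up to order `p` above `y`, away from the default values of `Real.log`. -/
theorem le_iterate_log_of_le {y b : ℝ} {p i : ℕ} (hi : i ≤ p) (h : Real.exp^[p] y ≤ b) :
    y ≤ Real.log^[i] b := by
  obtain ⟨m, rfl⟩ := Nat.exists_eq_add_of_le hi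
  rw [Function.iterate_add_apply] at h
  exact (le_iterate_exp y m).trans (le_iterate_log h)

theorem iterate_log_le_iterate_log {y b b' : ℝ} {p i : ℕ} (hy : 0 < y) (hi : i ≤ p)
    (h : Real.exp^[p] y ≤ b) (hb : b ≤ b') : Real.log^[i] b ≤ Real.log^[i] b' := by
  induction i with
  | zero => simpa using hb
  | succ i ih =>
    rw [Function.iterate_succ_apply', Function.iterate_succ_apply']
    exact Real.log_le_log (lt_of_lt_of_le hy (le_iterate_log_of_le (by omega) h)) (ih (by omega))

theorem iterate_log_le_self {y b : ℝ} {p i : ℕ} (hy : 0 < y) (hi : i ≤ p)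
    (h : Real.exp^[p] y ≤ b) : Real.log^[i] b ≤ b := by
  induction i with
  | zero => simp
  | succ i ih =>
    rw [Function.iterate_succ_apply']
    have h0 := lt_of_lt_of_le hy (le_iterate_log_of_le (i := i) (by omega) h)
    linarith [Real.log_le_sub_one_of_pos h0, ih (by omega)]

/-- Moves a factor `4` inside the iterated exponential, so that `exp (4 L)` is still a `k`-fold
exponential with only the innermost constant changed. -/
theorem four_mul_iterate_exp_le {y : ℝ} (hy : 1 ≤ y) (p : ℕ) :
    4 * Real.exp^[p] y ≤ Real.exp^[p] (4 * y) := by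
  induction p with
  | zero => simp
  | succ p ih =>
    rw [Function.iterate_succ_apply', Function.iterate_succ_apply']
    set z := Real.exp^[p] y
    have hz : 1 ≤ z := hy.trans (le_iterate_exp y p)
    refine le_trans ?_ (Real.exp_le_exp.2 ih)
    have h3 : (4 : ℝ) ≤ Real.exp (3 * z) := by linarith [Real.add_one_le_exp (3 * z)]
    calc 4 * Real.exp z ≤ Real.exp (3 * z) * Real.exp z := by gcongr
      _ = Real.exp (4 * z) := by rw [← Real.exp_add]; ring_nf

/-- The product `b ln b ⋯ ln^{(p-1)} b (ln^{(p)} b)^{(N+1)/2}`. -/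
def logProd (p : ℕ) (N b : ℝ) : ℝ :=
  (∏ i ∈ Finset.range p, Real.log^[i] b) * (Real.log^[p] b) ^ ((N + 1) / 2)

theorem prod_Icc_one_eq_prod_range {M : Type*} [CommMonoid M] (f : ℕ → M) (p : ℕ) :
    ∏ i ∈ Finset.Icc 1 p, f i = ∏ i ∈ Finset.range p, f (i + 1) := by
  induction p with
  | zero => simp
  | succ p ih => rw [Finset.prod_Icc_succ_top (by omega), ih, Finset.prod_range_succ]

/-- The source of the gain: `2N = 2 · (N+1)/2 + (N-1)`, so the Young function beats the squared
cutoff constants by a factor `(ln^{(p)} b)^{N-1}`. -/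
theorem logFactor_exp {p : ℕ} {N b : ℝ} (hb : 0 < Real.log^[p] b) :
    logFactor (p + 1) N (Real.exp b) = logProd p N b ^ 2 * (Real.log^[p] b) ^ (N - 1) := by
  have h2 : (Real.log^[p] b) ^ (2 * N) =
      ((Real.log^[p] b) ^ ((N + 1) / 2)) ^ 2 * (Real.log^[p] b) ^ (N - 1) := by
    rw [← Real.rpow_natCast, ← Real.rpow_mul hb.le, ← Real.rpow_add hb]
    congr 1; push_cast; ring
  simp only [logFactor, logProd, Nat.add_sub_cancel, prod_Icc_one_eq_prod_range,
    Function.iterate_succ_apply, Real.log_exp]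
  rw [h2, mul_pow, Finset.prod_pow]
  ring

theorem logProd_mono {p : ℕ} {N y b b' : ℝ} (hN : 1 < N) (hy : 0 < y)
    (h : Real.exp^[p] y ≤ b) (hb : b ≤ b') : logProd p N b ≤ logProd p N b' := by
  have h0 : ∀ i ≤ p, 0 ≤ Real.log^[i] b := fun i hi => hy.le.trans (le_iterate_log_of_le hi h)
  unfold logProd
  have h1 := h0 p le_rfl
  have h2 : ∀ i ∈ Finset.range p, 0 ≤ Real.log^[i] b := fun i hi =>
    h0 i (Finset.mem_range.1 hi).le
  have h3 := iterate_log_le_iterate_log hy le_rfl h hb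
  refine mul_le_mul (Finset.prod_le_prod h2 fun i hi =>
    iterate_log_le_iterate_log hy (Finset.mem_range.1 hi).le h hb)
    (Real.rpow_le_rpow h1 h3 (by linarith)) (Real.rpow_nonneg h1 _)
    (Finset.prod_nonneg fun i hi => (h2 i hi).trans
      (iterate_log_le_iterate_log hy (Finset.mem_range.1 hi).le h hb))

theorem one_le_logProd {p : ℕ} {N y b : ℝ} (hN : 1 < N) (hy : 1 ≤ y)
    (h : Real.exp^[p] y ≤ b) : 1 ≤ logProd p N b := by
  unfold logProd
  refine one_le_mul_of_one_le_of_one_le ?_ (Real.one_le_rpow (hy.trans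
    (le_iterate_log_of_le le_rfl h)) (by linarith))
  exact Finset.one_le_prod fun i hi => hy.trans
    (le_iterate_log_of_le (Finset.mem_range.1 hi).le h)

theorem one_le_threshold {k : ℕ} {N : ℝ} (hN : 1 < N) : 1 ≤ threshold k N :=
  le_trans (by linarith) (le_iterate_exp (2 * N) k)

theorem kappa_of_gt {p : ℕ} {N : ℝ} {j : ℕ} (h : threshold (p + 1) N < j) :
    kappa (p + 1) N j = logProd p N j := by
  simp [kappa, logProd, not_le.2 h]

theorem iterate_exp_le_threshold (p : ℕ) (N : ℝ) :
    Real.exp^[p] (2 * N) ≤ threshold (p + 1) N := by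
  rw [threshold, Function.iterate_succ_apply]
  exact iterate_exp_mono p (by linarith [Real.add_one_le_exp (2 * N)])

theorem one_le_kappa {k : ℕ} {N : ℝ} (hk : 1 ≤ k) (hN : 1 < N) {j : ℕ} (hj : 1 ≤ j) :
    1 ≤ kappa k N j := by
  obtain ⟨p, rfl⟩ := Nat.exists_eq_add_of_le' hk
  rcases le_or_gt (j : ℝ) (threshold (p + 1) N) with h | h
  · rw [kappa, if_pos h]
    exact one_le_pow₀ (by exact_mod_cast hj)
  · rw [kappa_of_gt h]
    exact one_le_logProd hN (y := 2 * N) (by linarith) ((iterate_exp_le_threshold p N).trans h.le)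

/-- The factor `E²` absorbs the range `j ≤ E`, where `κ(j) = j²`; beyond it monotonicity of the
product suffices. -/
theorem kappa_le {p : ℕ} {N y b : ℝ} (hN : 1 < N) {j : ℕ} (hy : 1 ≤ y)
    (hb : Real.exp^[p] y ≤ b) (hjb : (j : ℝ) ≤ b) :
    kappa (p + 1) N j ≤ threshold (p + 1) N ^ 2 * logProd p N b := by
  have hE := one_le_threshold (k := p + 1) hN
  have hP := one_le_logProd hN hy hb
  rcases le_or_gt (j : ℝ) (threshold (p + 1) N) with h | h
  · rw [kappa, if_pos h]
    have : (j : ℝ) ^ 2 ≤ threshold (p + 1) N ^ 2 := by gcongr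
    nlinarith
  · rw [kappa_of_gt h]
    have := logProd_mono (p := p) hN (y := 2 * N) (by linarith)
      ((iterate_exp_le_threshold p N).trans h.le) hjb
    nlinarith [one_le_pow₀ hE (n := 2)]

theorem logFactor_mono {k : ℕ} {N s s' : ℝ} (hN : 1 < N) (hs : threshold k N ≤ s)
    (h : s ≤ s') : logFactor k N s ≤ logFactor k N s' := by
  have h2 : 0 < 2 * N := by linarith
  have h0 : ∀ i ≤ k, 0 ≤ Real.log^[i] s := fun i hi => h2.le.trans (le_iterate_log_of_le hi hs)
  unfold logFactor
  refine mul_le_mul (Finset.prod_le_prod (fun i _ => sq_nonneg _) fun i hi => ?_)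
    (Real.rpow_le_rpow (h0 k le_rfl) (iterate_log_le_iterate_log h2 le_rfl hs h) h2.le)
    (Real.rpow_nonneg (h0 k le_rfl) _) (Finset.prod_nonneg fun i _ => sq_nonneg _)
  have hi' : i ≤ k := (Finset.mem_Icc.1 hi).2.trans (Nat.sub_le _ _)
  exact pow_le_pow_left₀ (h0 i hi') (iterate_log_le_iterate_log h2 hi' hs h) 2

theorem logFactor_pos {k : ℕ} {N s : ℝ} (hN : 1 < N) (hs : threshold k N ≤ s) :
    0 < logFactor k N s := by
  have h2 : 0 < 2 * N := by linarith
  have h0 : ∀ i ≤ k, 0 < Real.log^[i] s := fun i hi => h2.trans_le (le_iterate_log_of_le hi hs)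
  unfold logFactor
  refine mul_pos (Finset.prod_pos fun i hi => pow_pos (h0 i ?_) 2)
    (Real.rpow_pos_of_pos (h0 k le_rfl) _)
  exact (Finset.mem_Icc.1 hi).2.trans (Nat.sub_le _ _)

theorem youngPhi_nonneg {k : ℕ} {N : ℝ} (hN : 1 < N) (t : ℝ) : 0 ≤ youngPhi k N t := by
  unfold youngPhi
  split_ifs with h
  · exact mul_nonneg (sq_nonneg _) (logFactor_pos hN h).le
  · exact mul_nonneg (sq_nonneg _) (logFactor_pos hN le_rfl).le

/-- For `t² ≥ s` the factor multiplying `t²` in the Young function is at least its value at `s`; for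
`t² < s` the left side is nonpositive. -/
theorem sub_mul_logFactor_le_youngPhi {k : ℕ} {N s : ℝ} (hN : 1 < N) (hs : threshold k N ≤ s)
    (t : ℝ) : (t ^ 2 - s) * logFactor k N s ≤ youngPhi k N t := by
  have hp := logFactor_pos hN hs
  rcases le_total (t ^ 2) s with h | h
  · exact (mul_nonpos_of_nonpos_of_nonneg (by linarith) hp.le).trans (youngPhi_nonneg hN t)
  · rw [youngPhi, if_pos (hs.trans h)]
    have hs0 : 0 ≤ s := by linarith [one_le_threshold (k := k) hN]
    exact mul_le_mul (by linarith) (logFactor_mono hN hs h) hp.le (sq_nonneg _)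

theorem exists_rpow_le_mul_exp (q : ℝ) : ∃ D : ℝ, 1 ≤ D ∧ ∀ b : ℝ, 1 ≤ b →
    b ^ q ≤ D * Real.exp b := by
  obtain ⟨m, hm⟩ := exists_nat_ge q
  refine ⟨m.factorial, by exact_mod_cast Nat.succ_le_of_lt m.factorial_pos, fun b hb => ?_⟩
  have h1 : b ^ q ≤ b ^ m := by
    rw [← Real.rpow_natCast]; exact Real.rpow_le_rpow_of_exponent_le hb hm
  have h2 := Real.pow_div_factorial_le_exp b (by linarith) m
  rw [div_le_iff₀ (by positivity)] at h2
  linarith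

theorem logFactor_exp_le {p : ℕ} {N y b : ℝ} (hN : 1 < N) (hy : 1 ≤ y)
    (hb : Real.exp^[p] y ≤ b) :
    logFactor (p + 1) N (Real.exp b) ≤ b ^ (2 * p + 2 * N) := by
  have hb1 : 1 ≤ b := hy.trans ((le_iterate_exp y p).trans hb)
  have h0 : ∀ i ≤ p, 0 ≤ Real.log^[i] b := fun i hi =>
    (zero_le_one.trans hy).trans (le_iterate_log_of_le hi hb)
  have hle : ∀ i ≤ p, Real.log^[i] b ≤ b := fun i hi =>
    iterate_log_le_self (by linarith) hi hb
  simp only [logFactor, Nat.add_sub_cancel, prod_Icc_one_eq_prod_range,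
    Function.iterate_succ_apply, Real.log_exp]
  have h1 : ∏ i ∈ Finset.range p, (Real.log^[i] b) ^ 2 ≤ b ^ (2 * p : ℝ) := by
    calc ∏ i ∈ Finset.range p, (Real.log^[i] b) ^ 2 ≤ ∏ i ∈ Finset.range p, b ^ 2 :=
          Finset.prod_le_prod (fun _ _ => sq_nonneg _) fun i hi =>
            pow_le_pow_left₀ (h0 i (Finset.mem_range.1 hi).le) (hle i (Finset.mem_range.1 hi).le) 2
      _ = b ^ (2 * p : ℝ) := by
          rw [Finset.prod_const, Finset.card_range, ← pow_mul, ← Real.rpow_natCast]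
          push_cast; rfl
  rw [Real.rpow_add (by linarith)]
  exact mul_le_mul h1 (Real.rpow_le_rpow (h0 p le_rfl) (hle p le_rfl) (by linarith))
    (Real.rpow_nonneg (h0 p le_rfl) _) (by positivity)

/-- The arithmetic of the De Giorgi iteration: with `b = L + j` and `s = e^b`, a quantity bounded
by `e^{-4b}` decreases by a factor `e^{-4}` in one step. -/
theorem exists_iteration_constant {k : ℕ} {N : ℝ} (hk : 1 ≤ k) (hN : 1 < N) {B τ : ℝ}
    (hB : 0 < B) (hτ : 0 < τ) :
    ∃ C₂ : ℝ, 0 < C₂ ∧ ∀ F : ℝ, 1 ≤ F → ∃ L : ℝ,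
      4 * L ≤ Real.exp^[k - 1] (C₂ * F ^ (2 / (N - 1))) ∧
      ∀ j : ℕ, 1 ≤ j → threshold k N ≤ Real.exp (L + j) ∧
        B * F ^ 2 * kappa k N j ^ 2 *
          (Real.exp (L + j) * (τ * kappa k N j ^ 2 * Real.exp (-4 * (L + j))) +
            1 / logFactor k N (Real.exp (L + j))) ≤ Real.exp (-4) := by
  obtain ⟨p, rfl⟩ := Nat.exists_eq_add_of_le' hk
  simp only [Nat.add_sub_cancel]
  obtain ⟨D, hD1, hD⟩ := exists_rpow_le_mul_exp (2 * p + 2 * N)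
  set E := threshold (p + 1) N with hE
  have hE1 : 1 ≤ E := one_le_threshold hN
  -- `G / h` will bound the sum of the small-support term and `1 / h`; `Q` is the size which `m /
  -- F²` must reach for the factor to be at most `e^{-4}`.
  set G := τ * E ^ 4 * D ^ 2 + 1 with hG
  have hG0 : 0 < G := by positivity
  set Q := B * G * E ^ 4 * Real.exp 4 with hQ
  have hQ0 : 0 < Q := by positivity
  -- The first entry puts `e^b` above the threshold, the second gives `y^(N-1) ≥ Q F²`.
  set C := max (2 * N) (Q ^ (1 / (N - 1))) with hC
  have hC2 : 2 * N ≤ C := le_max_left _ _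
  have hN1 : 0 < N - 1 := by linarith
  refine ⟨4 * C, by linarith, fun F hF => ?_⟩
  set y := C * F ^ (2 / (N - 1)) with hy
  have hF1 : 1 ≤ F ^ (2 / (N - 1)) := Real.one_le_rpow hF (by positivity)
  have hCy : C ≤ y := le_mul_of_one_le_right (by linarith) hF1
  have hy1 : 1 ≤ y := by linarith
  have hyN : Q * F ^ 2 ≤ y ^ (N - 1) := by
    rw [hy, Real.mul_rpow (by linarith) (by positivity), ← Real.rpow_mul (by linarith),
      div_mul_cancel₀ _ hN1.ne', Real.rpow_two]
    refine mul_le_mul_of_nonneg_right ?_ (sq_nonneg F)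
    calc Q = (Q ^ (1 / (N - 1))) ^ (N - 1) := by
          rw [← Real.rpow_mul hQ0.le, one_div_mul_cancel hN1.ne', Real.rpow_one]
      _ ≤ C ^ (N - 1) := Real.rpow_le_rpow (by positivity) (le_max_right _ _) hN1.le
  refine ⟨Real.exp^[p] y, ?_, fun j hj => ?_⟩
  · rw [mul_assoc, ← hy]; exact four_mul_iterate_exp_le hy1 p
  set b := Real.exp^[p] y + j with hb
  have hj0 : (0 : ℝ) ≤ j := Nat.cast_nonneg j
  have hL1 : 1 ≤ Real.exp^[p] y := hy1.trans (le_iterate_exp y p)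
  have hbL : Real.exp^[p] y ≤ b := by linarith
  have hEb : E ≤ Real.exp b := by
    rw [hE, threshold, Function.iterate_succ_apply']
    exact Real.exp_le_exp.2 ((iterate_exp_mono p (hC2.trans hCy)).trans hbL)
  refine ⟨hEb, ?_⟩
  have hl : y ≤ Real.log^[p] b := le_iterate_log_of_le le_rfl hbL
  have hlpos : 0 < Real.log^[p] b := by linarith
  have hh := logFactor_exp (N := N) hlpos
  have hhD : logFactor (p + 1) N (Real.exp b) ≤ D * Real.exp b :=
    (logFactor_exp_le hN hy1 hbL).trans (hD b (by linarith))
  have hP := one_le_logProd hN hy1 hbL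
  have hκ := kappa_le hN hy1 hbL (j := j) (by linarith)
  have hκ0 := one_le_kappa (k := p + 1) (by omega) hN hj
  have hκ2 : kappa (p + 1) N j ^ 2 ≤ E ^ 4 * logProd p N b ^ 2 := by
    calc kappa (p + 1) N j ^ 2 ≤ (E ^ 2 * logProd p N b) ^ 2 := by gcongr
      _ = _ := by ring
  have hh0 := logFactor_pos hN hEb
  set h := logFactor (p + 1) N (Real.exp b)
  set P := logProd p N b
  set κ := kappa (p + 1) N j
  set m := (Real.log^[p] b) ^ (N - 1) with hm
  have hm1 : 1 ≤ m := Real.one_le_rpow (hy1.trans hl) hN1.le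
  have hmQ : Q * F ^ 2 ≤ m := hyN.trans (Real.rpow_le_rpow (by linarith) hl hN1.le)
  have hPh : P ^ 2 ≤ h := by rw [hh]; nlinarith [sq_nonneg P]
  -- Since `κ² ≤ E⁴ h` and `h ≤ D e^b`, multiplying by `h` leaves `e^{2b} e^{-3b} ≤ 1`: the
  -- small-support term is dominated by a multiple of `1 / h`.
  have h1 : Real.exp b * (τ * κ ^ 2 * Real.exp (-4 * b)) ≤ τ * E ^ 4 * D ^ 2 / h := by
    rw [le_div_iff₀ hh0]
    have e1 : Real.exp b * (τ * κ ^ 2 * Real.exp (-4 * b)) * h =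
        τ * κ ^ 2 * h * Real.exp (-3 * b) := by
      have : Real.exp (-3 * b) = Real.exp b * Real.exp (-4 * b) := by
        rw [← Real.exp_add]; ring_nf
      rw [this]; ring
    have e2 : Real.exp b * Real.exp b * Real.exp (-3 * b) ≤ 1 := by
      rw [← Real.exp_add, ← Real.exp_add]
      exact Real.exp_le_one_iff.2 (by linarith)
    rw [e1]
    calc τ * κ ^ 2 * h * Real.exp (-3 * b) ≤
          τ * (E ^ 4 * h) * h * Real.exp (-3 * b) := by
          gcongr; exact hκ2.trans (by gcongr)
      _ ≤ τ * (E ^ 4 * (D * Real.exp b)) * (D * Real.exp b) * Real.exp (-3 * b) := by gcongr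
      _ = τ * E ^ 4 * D ^ 2 * (Real.exp b * Real.exp b * Real.exp (-3 * b)) := by ring
      _ ≤ τ * E ^ 4 * D ^ 2 * 1 := by gcongr
      _ = _ := mul_one _
  calc B * F ^ 2 * κ ^ 2 * (Real.exp b * (τ * κ ^ 2 * Real.exp (-4 * b)) + 1 / h)
      ≤ B * F ^ 2 * (E ^ 4 * P ^ 2) * (τ * E ^ 4 * D ^ 2 / h + 1 / h) := by gcongr
    _ = B * G * E ^ 4 * F ^ 2 / m := by
        rw [← add_div, ← hG, hh]
        have : P ≠ 0 := by positivity
        field_simp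
    _ ≤ Real.exp (-4) := by
        rw [div_le_iff₀ (by linarith)]
        have e4 : Real.exp (-4) * Real.exp 4 = 1 := by rw [← Real.exp_add]; simp
        calc B * G * E ^ 4 * F ^ 2 = Real.exp (-4) * (Q * F ^ 2) := by
              rw [hQ]; linear_combination (-(B * G * E ^ 4 * F ^ 2)) * e4
          _ ≤ _ := by gcongr

/-! ### Lipschitz functions and gradients -/

section Gradient

variable {n : ℕ}

theorem measurable_gradient (v : Eucl n → ℝ) : Measurable (gradient v) :=
  (InnerProductSpace.toDual ℝ (Eucl n)).symm.continuous.measurable.comp (measurable_fderiv ℝ v)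

theorem gradient_congr {v v' : Eucl n → ℝ} {x : Eucl n} (h : v =ᶠ[𝓝 x] v') :
    gradient v x = gradient v' x := by
  simp only [gradient, h.fderiv_eq]

theorem gradient_of_isLocalMin {v : Eucl n → ℝ} {x : Eucl n} (h : IsLocalMin v x) :
    gradient v x = 0 := by
  simp only [gradient, h.fderiv_eq_zero, map_zero]

theorem gradient_of_isLocalMax {v : Eucl n → ℝ} {x : Eucl n} (h : IsLocalMax v x) :
    gradient v x = 0 := by
  simp only [gradient, h.fderiv_eq_zero, map_zero]

theorem gradient_eq_zero_of_notMem_tsupport {v : Eucl n → ℝ} {x : Eucl n} (h : x ∉ tsupport v) :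
    gradient v x = 0 := by
  simp only [gradient, fderiv_of_notMem_tsupport ℝ h, map_zero]

theorem norm_gradient_le {v : Eucl n → ℝ} {L : ℝ≥0} (h : LipschitzWith L v) (x : Eucl n) :
    ‖gradient v x‖ ≤ L := by
  simp only [gradient, LinearIsometryEquiv.norm_map]
  exact norm_fderiv_le_of_lipschitz ℝ h

theorem gradient_mul {η v : Eucl n → ℝ} {x : Eucl n} (hη : DifferentiableAt ℝ η x)
    (hv : DifferentiableAt ℝ v x) :
    gradient (fun y => η y * v y) x = η x • gradient v x + v x • gradient η x := by
  simp only [gradient, fderiv_fun_mul hη hv, map_add, map_smulₛₗ]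
  rfl

/-- Where the truncation is active it has a local minimum, so its gradient vanishes there. -/
theorem gradient_posPart_sub {v : Eucl n → ℝ} {x : Eucl n} (hv : ContinuousAt v x) (C : ℝ) :
    gradient (fun y => max (v y - C) 0) x = if C < v x then gradient v x else 0 := by
  split_ifs with h
  · have h1 : (fun y => max (v y - C) 0) =ᶠ[𝓝 x] fun y => v y - C := by
      filter_upwards [hv.eventually (lt_mem_nhds h)] with y hy
      exact max_eq_left (by linarith)
    rw [gradient_congr h1]
    simp only [gradient, fderiv_sub_const]
  · refine gradient_of_isLocalMin (Eventually.of_forall fun y => ?_)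
    show max (v x - C) 0 ≤ _
    rw [max_eq_right (by linarith)]
    exact le_max_right _ _

/-- Outside `0 < v < 1` the clamped function has a global extremum at the point, so its derivative,
zero by default if it fails to exist, vanishes there. -/
theorem gradient_clamp {v : Eucl n → ℝ} {x : Eucl n} (hv : ContinuousAt v x) :
    gradient (fun y => max (min (v y) 1) 0) x = gradient v x ∨
      gradient (fun y => max (min (v y) 1) 0) x = 0 := by
  rcases le_or_gt (v x) 0 with h0 | h0
  · refine Or.inr (gradient_of_isLocalMin (Eventually.of_forall fun y => ?_))
    show max (min (v x) 1) 0 ≤ _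
    rw [max_eq_right ((min_le_left _ _).trans h0)]
    exact le_max_right _ _
  rcases lt_or_ge (v x) 1 with h1 | h1
  · refine Or.inl (gradient_congr ?_)
    filter_upwards [hv.eventually (lt_mem_nhds h0), hv.eventually (gt_mem_nhds h1)] with y hy hy'
    rw [min_eq_left hy'.le, max_eq_left hy.le]
  · refine Or.inr (gradient_of_isLocalMax (Eventually.of_forall fun y => ?_))
    show _ ≤ max (min (v x) 1) 0
    rw [min_eq_right h1]
    exact (max_le_max (min_le_right _ _) le_rfl)

/-- Rademacher's theorem on neighbourhoods, countably many of which cover `Ω`. -/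
theorem ae_differentiableAt_of_locallyLipschitzOn {Ω : Set (Eucl n)} (hΩ : IsOpen Ω)
    {v : Eucl n → ℝ} (hv : LocallyLipschitzOn Ω v) :
    ∀ᵐ x ∂volume.restrict Ω, DifferentiableAt ℝ v x := by
  rw [ae_restrict_iff' hΩ.measurableSet]
  have key : ∀ x ∈ Ω, ∃ t ∈ 𝓝 x, ∀ᵐ y ∂(volume : Measure (Eucl n)), y ∈ t →
      DifferentiableAt ℝ v y := by
    intro x hx
    obtain ⟨L, t, ht, hL⟩ := hv hx
    rw [hΩ.nhdsWithin_eq hx] at ht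
    refine ⟨interior t, interior_mem_nhds.2 ht, ?_⟩
    filter_upwards [hL.ae_differentiableWithinAt_of_mem] with y hy hyt
    exact (hy (interior_subset hyt)).differentiableAt (mem_interior_iff_mem_nhds.1 hyt)
  choose! t ht hd using key
  obtain ⟨s, hsΩ, hsc, hs⟩ := TopologicalSpace.countable_cover_nhdsWithin
    (fun x hx => mem_nhdsWithin_of_mem_nhds (ht x hx) : ∀ x ∈ Ω, t x ∈ 𝓝[Ω] x)
  have := (ae_ball_iff hsc).2 fun x hx => hd x (hsΩ hx)
  filter_upwards [this] with y hy hyΩ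
  obtain ⟨x, hxs, hyx⟩ := Set.mem_iUnion₂.1 (hs hyΩ)
  exact hy x hxs hyx

/-- `v` is controlled only on the support of `η`. When one of two points lies outside it, the
product vanishes there and the Lipschitz bound for `η` alone gives the estimate. -/
theorem exists_lipschitzWith_mul {η v : Eucl n → ℝ} {L L' : ℝ≥0} (hη : LipschitzWith L η)
    (hc : HasCompactSupport η) (hv : LipschitzOnWith L' v (tsupport η)) :
    ∃ M : ℝ≥0, LipschitzWith M fun x => η x * v x := by
  obtain ⟨a, ha⟩ := hc.isCompact.exists_bound_of_continuousOn hη.continuous.continuousOn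
  obtain ⟨b, hb⟩ := hc.isCompact.exists_bound_of_continuousOn hv.continuousOn
  have hb' : ∀ x ∈ tsupport η, |v x| ≤ |b| := fun x hx => (hb x hx).trans (le_abs_self b)
  have ha' : ∀ x ∈ tsupport η, |η x| ≤ |a| := fun x hx => (ha x hx).trans (le_abs_self a)
  have hzero : ∀ x, x ∉ tsupport η → η x = 0 := fun x hx => image_eq_zero_of_notMem_tsupport hx
  have hη' : ∀ x y, |η x - η y| ≤ L * dist x y := fun x y => hη.dist_le_mul x y
  refine ⟨Real.toNNReal (L * |b| + |a| * L'), LipschitzWith.of_dist_le_mul fun x y => ?_⟩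
  rw [Real.coe_toNNReal _ (by positivity), Real.dist_eq]
  have hd : 0 ≤ dist x y := dist_nonneg
  have hoff : ∀ x y, y ∉ tsupport η → |η x * v x - η y * v y| ≤
      (L * |b| + |a| * L') * dist x y := by
    intro x y hy
    rw [hzero y hy]
    by_cases hx : x ∈ tsupport η
    · rw [zero_mul, sub_zero, abs_mul]
      calc |η x| * |v x| ≤ (L * dist x y) * |b| :=
          mul_le_mul (by simpa [hzero y hy] using hη' x y) (hb' x hx) (abs_nonneg _) (by positivity)
        _ ≤ (L * |b| + |a| * L') * dist x y := by
          have : 0 ≤ |a| * L' * dist x y := by positivity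
          linarith
    · rw [hzero x hx]; simp only [zero_mul, sub_zero, abs_zero]; positivity
  by_cases hy : y ∈ tsupport η
  · by_cases hx : x ∈ tsupport η
    · calc |η x * v x - η y * v y| = |(η x - η y) * v x + η y * (v x - v y)| := by ring_nf
        _ ≤ |η x - η y| * |v x| + |η y| * |v x - v y| := by
          rw [← abs_mul, ← abs_mul]; exact abs_add_le _ _
        _ ≤ (L * dist x y) * |b| + |a| * (L' * dist x y) := by
          exact add_le_add
            (mul_le_mul (hη' x y) (hb' x hx) (abs_nonneg _) (by positivity))
            (mul_le_mul (ha' y hy) (hv.dist_le_mul x hx y hy) (abs_nonneg _) (abs_nonneg _))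
        _ = _ := by ring
    · rw [abs_sub_comm, dist_comm]; exact hoff y x hx
  · exact hoff x y hy

theorem LipC.mul_of_locallyLipschitzOn {Ω U : Set (Eucl n)} {η v : Eucl n → ℝ}
    (hη : LipC U η) (hU : U ⊆ Ω) (hv : LocallyLipschitzOn Ω v) :
    LipC U fun x => η x * v x := by
  obtain ⟨⟨L, hL⟩, hc, ht⟩ := hη
  obtain ⟨L', hL'⟩ := (hv.mono (ht.trans hU)).exists_lipschitzOnWith_of_compact hc.isCompact
  exact ⟨exists_lipschitzWith_mul hL hc hL', hc.mul_right,
    (tsupport_mul_subset_left).trans ht⟩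

theorem LipC.mono {U V : Set (Eucl n)} {v : Eucl n → ℝ} (h : LipC U v) (hUV : U ⊆ V) : LipC V v :=
  ⟨h.1, h.2.1, h.2.2.trans hUV⟩

theorem LipC.sq {U : Set (Eucl n)} {v : Eucl n → ℝ} (h : LipC U v) :
    LipC U fun x => v x ^ 2 := by
  obtain ⟨⟨L, hL⟩, _⟩ := id h
  simp_rw [pow_two]
  exact h.mul_of_locallyLipschitzOn (Set.subset_univ U) hL.locallyLipschitz.locallyLipschitzOn

theorem LipC.clamp {U : Set (Eucl n)} {v : Eucl n → ℝ} (h : LipC U v) :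
    LipC U fun x => max (min (v x) 1) 0 := by
  obtain ⟨⟨L, hL⟩, hc, ht⟩ := h
  have h0 : Function.support (fun x => max (min (v x) 1) 0) ⊆ Function.support v := by
    intro x hx hv
    simp [hv] at hx
  refine ⟨⟨L, (hL.min_const 1).max_const 0⟩, hc.mono h0, (closure_mono h0).trans ht⟩

theorem LocallyLipschitzOn.posPart_sub {Ω : Set (Eucl n)} {v : Eucl n → ℝ}
    (hv : LocallyLipschitzOn Ω v) (C : ℝ) :
    LocallyLipschitzOn Ω fun x => max (v x - C) 0 := by
  intro x hx
  obtain ⟨L, t, ht, hL⟩ := hv hx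
  refine ⟨L, t, ht, LipschitzOnWith.of_dist_le_mul fun y hy z hz => ?_⟩
  refine le_trans ?_ (hL.dist_le_mul y hy z hz)
  rw [Real.dist_eq, Real.dist_eq]
  refine (abs_max_sub_max_le_abs _ _ _).trans (le_of_eq ?_)
  congr 1; ring

end Gradient

/-! ### Quadratic forms -/

section QuadraticForm

variable {n : ℕ}

theorem mulE_add (M : Matrix (Fin n) (Fin n) ℝ) (ξ ζ : Eucl n) :
    mulE M (ξ + ζ) = mulE M ξ + mulE M ζ := by
  simp [mulE, Matrix.mulVec_add]

theorem mulE_smul (M : Matrix (Fin n) (Fin n) ℝ) (a : ℝ) (ξ : Eucl n) :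
    mulE M (a • ξ) = a • mulE M ξ := by
  simp [mulE, Matrix.mulVec_smul]

theorem inner_mulE_eq_sum (M : Matrix (Fin n) (Fin n) ℝ) (ξ ζ : Eucl n) :
    inner ℝ ξ (mulE M ζ) = ∑ i, ∑ j, ξ i * (M i j * ζ j) := by
  simp only [PiLp.inner_apply, mulE, Matrix.mulVec, dotProduct]
  refine Finset.sum_congr rfl fun i _ => ?_
  simp only [RCLike.inner_apply, conj_trivial, Finset.sum_mul]
  exact Finset.sum_congr rfl fun j _ => by ring

theorem norm_mulE_sq_eq_sum (M : Matrix (Fin n) (Fin n) ℝ) (ζ : Eucl n) :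
    ‖mulE M ζ‖ ^ 2 = ∑ i, (∑ j, M i j * ζ j) ^ 2 := by
  simp [EuclideanSpace.norm_sq_eq, mulE, Matrix.mulVec, dotProduct]

/-- The quadratic form `ξᵗ M ξ`. -/
def quad (M : Matrix (Fin n) (Fin n) ℝ) (ξ : Eucl n) : ℝ := inner ℝ ξ (mulE M ξ)

variable {M : Matrix (Fin n) (Fin n) ℝ}

theorem quad_nonneg (hM : M.PosSemidef) (ξ : Eucl n) : 0 ≤ quad M ξ := by
  have h := hM.dotProduct_mulVec_nonneg ξ.ofLp
  rw [quad, inner_mulE_eq_sum]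
  simpa [dotProduct, Matrix.mulVec, Finset.mul_sum] using h

theorem inner_mulE_comm (hM : M.PosSemidef) (ξ ζ : Eucl n) :
    inner ℝ ξ (mulE M ζ) = inner ℝ ζ (mulE M ξ) := by
  rw [inner_mulE_eq_sum, inner_mulE_eq_sum, Finset.sum_comm]
  refine Finset.sum_congr rfl fun i _ => Finset.sum_congr rfl fun j _ => ?_
  have : M j i = M i j := by simpa using hM.isHermitian.apply i j
  rw [this]; ring

theorem quad_add (hM : M.PosSemidef) (ξ ζ : Eucl n) :
    quad M (ξ + ζ) = quad M ξ + 2 * inner ℝ ξ (mulE M ζ) + quad M ζ := by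
  simp only [quad, mulE_add, inner_add_left, inner_add_right]
  rw [inner_mulE_comm hM ζ ξ]; ring

theorem quad_smul (a : ℝ) (ξ : Eucl n) : quad M (a • ξ) = a ^ 2 * quad M ξ := by
  simp only [quad, mulE_smul, inner_smul_left, inner_smul_right, conj_trivial]; ring

theorem quad_zero : quad M (0 : Eucl n) = 0 := by simp [quad]

theorem neg_two_mul_inner_mulE_le (hM : M.PosSemidef) (ξ ζ : Eucl n) :
    -(2 * inner ℝ ξ (mulE M ζ)) ≤ quad M ξ + quad M ζ := by
  linarith [quad_nonneg hM (ξ + ζ), quad_add hM ξ ζ]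

theorem two_mul_inner_mulE_le (hM : M.PosSemidef) (ξ ζ : Eucl n) :
    2 * inner ℝ ξ (mulE M ζ) ≤ quad M ξ + quad M ζ := by
  have h := neg_two_mul_inner_mulE_le hM ((-1 : ℝ) • ξ) ζ
  rw [quad_smul, inner_smul_left] at h
  simp only [conj_trivial] at h
  linarith

theorem quad_add_le (hM : M.PosSemidef) (ξ ζ : Eucl n) :
    quad M (ξ + ζ) ≤ 2 * quad M ξ + 2 * quad M ζ := by
  linarith [two_mul_inner_mulE_le hM ξ ζ, quad_add hM ξ ζ]

theorem quad_sub_comm (ξ ζ : Eucl n) : quad M (ξ - ζ) = quad M (ζ - ξ) := by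
  rw [← neg_sub ζ ξ, ← neg_one_smul ℝ, quad_smul]; ring

theorem quad_le_of_bound {C : ℝ} (hC : ∀ i j, |M i j| ≤ C) (ξ : Eucl n) :
    quad M ξ ≤ n ^ 2 * C * ‖ξ‖ ^ 2 := by
  rw [quad, inner_mulE_eq_sum]
  have h : ∀ i j, ξ i * (M i j * ξ j) ≤ C * ‖ξ‖ ^ 2 := fun i j => by
    have hi : |ξ i| ≤ ‖ξ‖ := by simpa using PiLp.norm_apply_le ξ i
    have hj : |ξ j| ≤ ‖ξ‖ := by simpa using PiLp.norm_apply_le ξ j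
    calc ξ i * (M i j * ξ j) ≤ |ξ i| * (|M i j| * |ξ j|) := by
          rw [← abs_mul, ← abs_mul]; exact le_abs_self _
      _ ≤ ‖ξ‖ * (C * ‖ξ‖) := by gcongr; exacts [(abs_nonneg _).trans (hC i j), hC i j]
      _ = _ := by ring
  calc ∑ i, ∑ j, ξ i * (M i j * ξ j) ≤ ∑ _i : Fin n, ∑ _j : Fin n, C * ‖ξ‖ ^ 2 :=
        Finset.sum_le_sum fun i _ => Finset.sum_le_sum fun j _ => h i j
    _ = _ := by simp; ring

theorem norm_mulE_add_sq_le (ξ ζ : Eucl n) :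
    ‖mulE M (ξ + ζ)‖ ^ 2 ≤ 2 * ‖mulE M ξ‖ ^ 2 + 2 * ‖mulE M ζ‖ ^ 2 := by
  rw [mulE_add]
  have h := norm_add_le (mulE M ξ) (mulE M ζ)
  nlinarith [norm_nonneg (mulE M ξ + mulE M ζ), sq_nonneg (‖mulE M ξ‖ - ‖mulE M ζ‖)]

theorem aemeasurable_inner_mulE {μ : Measure (Eucl n)}
    {A : Eucl n → Matrix (Fin n) (Fin n) ℝ} (hA : ∀ i j, AEMeasurable (fun x => A x i j) μ)
    {G H : Eucl n → Eucl n} (hG : AEStronglyMeasurable G μ) (hH : AEStronglyMeasurable H μ) :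
    AEMeasurable (fun x => inner ℝ (G x) (mulE (A x) (H x))) μ := by
  simp only [inner_mulE_eq_sum]
  have h1 : ∀ {G : Eucl n → Eucl n}, AEStronglyMeasurable G μ → ∀ i,
      AEMeasurable (fun x => G x i) μ := fun hG i =>
    (EuclideanSpace.proj (𝕜 := ℝ) i).continuous.measurable.comp_aemeasurable hG.aemeasurable
  exact Finset.aemeasurable_fun_sum _ fun i _ => Finset.aemeasurable_fun_sum _ fun j _ =>
    (h1 hG i).mul ((hA i j).mul (h1 hH j))

theorem aemeasurable_quad {μ : Measure (Eucl n)}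
    {A : Eucl n → Matrix (Fin n) (Fin n) ℝ} (hA : ∀ i j, AEMeasurable (fun x => A x i j) μ)
    {G : Eucl n → Eucl n} (hG : AEStronglyMeasurable G μ) :
    AEMeasurable (fun x => quad (A x) (G x)) μ := aemeasurable_inner_mulE hA hG hG

theorem aemeasurable_norm_mulE_sq {μ : Measure (Eucl n)}
    {S : Eucl n → Matrix (Fin n) (Fin n) ℝ} (hS : ∀ i j, AEMeasurable (fun x => S x i j) μ)
    {G : Eucl n → Eucl n} (hG : AEStronglyMeasurable G μ) :
    AEMeasurable (fun x => ‖mulE (S x) (G x)‖ ^ 2) μ := by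
  simp only [norm_mulE_sq_eq_sum]
  refine Finset.aemeasurable_fun_sum _ fun i _ =>
    (Finset.aemeasurable_fun_sum _ fun j _ => (hS i j).mul ?_).pow_const 2
  exact (EuclideanSpace.proj (𝕜 := ℝ) j).continuous.measurable.comp_aemeasurable hG.aemeasurable

end QuadraticForm

/-! ### Truncations in the degenerate Sobolev space -/

section Sobolev

variable {n : ℕ}

theorem IsCoefficient.aemeasurable_sqrt {Ω : Set (Eucl n)} {w : Eucl n → ℝ≥0}
    {A S : Eucl n → Matrix (Fin n) (Fin n) ℝ} {c₀ C₀ : ℝ} (h : IsCoefficient Ω w A S c₀ C₀)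
    (hΩ : IsOpen Ω) (i j : Fin n) : AEMeasurable (fun x => S x i j) (volume.restrict Ω) := by
  obtain ⟨L, hL⟩ := h.lipschitz i j
  exact (hL.continuousOn.aestronglyMeasurable hΩ.measurableSet).aemeasurable

theorem ofReal_le_two_mul_add {q a b : ℝ} (ha : 0 ≤ a) (hb : 0 ≤ b) (h : q ≤ 2 * a + 2 * b) :
    ENNReal.ofReal q ≤ 2 * ENNReal.ofReal a + 2 * ENNReal.ofReal b := by
  rw [← ENNReal.ofReal_ofNat, ← ENNReal.ofReal_mul (by norm_num),
    ← ENNReal.ofReal_mul (by norm_num), ← ENNReal.ofReal_add (by positivity) (by positivity)]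
  exact ENNReal.ofReal_le_ofReal h

theorem energy_eq (A : Eucl n → Matrix (Fin n) (Fin n) ℝ) (U : Set (Eucl n))
    (G : Eucl n → Eucl n) : energy A U G = ∫⁻ x in U, ENNReal.ofReal (quad (A x) (G x)) := rfl

theorem SobolevLimit.mono {A : Eucl n → Matrix (Fin n) (Fin n) ℝ} {U V : Set (Eucl n)}
    {vj : ℕ → Eucl n → ℝ} {v : Eucl n → ℝ} {G : Eucl n → Eucl n}
    (h : SobolevLimit A V vj v G) (hUV : U ⊆ V) : SobolevLimit A U vj v G where
  meas := h.meas.mono_measure (Measure.restrict_mono_set _ hUV)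
  meas_grad := h.meas_grad.mono_measure (Measure.restrict_mono_set _ hUV)
  tendsto := tendsto_of_tendsto_of_tendsto_of_le_of_le tendsto_const_nhds h.tendsto
    (fun _ => zero_le) fun _ => lintegral_mono_set hUV
  tendsto_grad := tendsto_of_tendsto_of_tendsto_of_le_of_le tendsto_const_nhds h.tendsto_grad
    (fun _ => zero_le) fun _ => lintegral_mono_set hUV

theorem SobolevLimit.comp {A : Eucl n → Matrix (Fin n) (Fin n) ℝ} {U : Set (Eucl n)}
    {vj : ℕ → Eucl n → ℝ} {v : Eucl n → ℝ} {G : Eucl n → Eucl n}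
    (h : SobolevLimit A U vj v G) {m : ℕ → ℕ} (hm : Tendsto m atTop atTop) :
    SobolevLimit A U (fun j => vj (m j)) v G where
  meas := h.meas
  meas_grad := h.meas_grad
  tendsto := h.tendsto.comp hm
  tendsto_grad := h.tendsto_grad.comp hm

/-- `L²` convergence gives convergence in measure of the squared differences, hence almost
everywhere along a subsequence. -/
theorem SobolevLimit.exists_subseq_ae {A : Eucl n → Matrix (Fin n) (Fin n) ℝ} {U : Set (Eucl n)}
    {vj : ℕ → Eucl n → ℝ} {v : Eucl n → ℝ} {G : Eucl n → Eucl n}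
    (h : SobolevLimit A U vj v G)
    (hm : ∀ j, AEStronglyMeasurable (vj j) (volume.restrict U)) :
    ∃ m : ℕ → ℕ, StrictMono m ∧
      ∀ᵐ x ∂volume.restrict U, Tendsto (fun j => vj (m j) x) atTop (𝓝 (v x)) := by
  have h1 : TendstoInMeasure (volume.restrict U) (fun j x => (vj j x - v x) ^ 2) atTop
      (fun _ => 0) := by
    refine tendstoInMeasure_of_tendsto_eLpNorm one_ne_zero
      (fun j => ((hm j).sub h.meas).pow 2) aestronglyMeasurable_const ?_
    refine h.tendsto.congr fun j => ?_
    rw [eLpNorm_one_eq_lintegral_enorm]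
    refine lintegral_congr fun x => ?_
    simp only [Pi.sub_apply, sub_zero]
    exact (Real.enorm_of_nonneg (sq_nonneg _)).symm
  obtain ⟨m, hm, hx⟩ := h1.exists_seq_tendsto_ae
  refine ⟨m, hm, ?_⟩
  filter_upwards [hx] with x hx
  rw [tendsto_iff_dist_tendsto_zero]
  have := (Real.continuous_sqrt.tendsto 0).comp hx
  simpa [Function.comp_def, Real.sqrt_sq_eq_abs, Real.dist_eq] using this

theorem MemWA.exists_approx {A : Eucl n → Matrix (Fin n) (Fin n) ℝ} {Ω : Set (Eucl n)}
    (hΩ : IsOpen Ω) {v : Eucl n → ℝ} {G : Eucl n → Eucl n} (h : MemWA A Ω v G) :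
    ∃ vj : ℕ → Eucl n → ℝ, (∀ j, LocallyLipschitzOn Ω (vj j)) ∧ SobolevLimit A Ω vj v G ∧
      ∀ᵐ x ∂volume.restrict Ω, Tendsto (fun j => vj j x) atTop (𝓝 (v x)) := by
  obtain ⟨vj, h1, h2⟩ := h
  obtain ⟨m, hm, hx⟩ := h2.exists_subseq_ae fun j =>
    (h1 j).1.continuousOn.aestronglyMeasurable hΩ.measurableSet
  exact ⟨_, fun j => (h1 (m j)).1, h2.comp hm.tendsto_atTop, hx⟩

theorem MemWA.energy_lt_top {A : Eucl n → Matrix (Fin n) (Fin n) ℝ} {Ω : Set (Eucl n)}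
    (hm : ∀ i j, AEMeasurable (fun x => A x i j) (volume.restrict Ω))
    (hA : ∀ᵐ x ∂volume.restrict Ω, (A x).PosSemidef)
    {v : Eucl n → ℝ} {G : Eucl n → Eucl n} (h : MemWA A Ω v G) : energy A Ω G < ∞ := by
  obtain ⟨vj, h1, h2⟩ := h
  obtain ⟨j, hj⟩ := (h2.tendsto_grad.eventually (gt_mem_nhds ENNReal.zero_lt_top)).exists
  have hle : energy A Ω G ≤ 2 * energy A Ω (gradient (vj j)) +
      2 * energy A Ω fun x => gradient (vj j) x - G x := by
    simp only [energy_eq]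
    rw [← lintegral_const_mul' _ _ (by simp), ← lintegral_const_mul' _ _ (by simp),
      ← lintegral_add_left' ((aemeasurable_quad hm
        (measurable_gradient _).aestronglyMeasurable).ennreal_ofReal.const_mul 2)]
    refine lintegral_mono_ae ?_
    filter_upwards [hA] with x hx
    have h3 := quad_add_le hx (gradient (vj j) x) (G x - gradient (vj j) x)
    rw [add_sub_cancel, quad_sub_comm (G x)] at h3
    have h0 := quad_nonneg hx (gradient (vj j) x)
    have h0' := quad_nonneg hx (gradient (vj j) x - G x)
    exact ofReal_le_two_mul_add h0 h0' h3
  exact hle.trans_lt (ENNReal.add_lt_top.2 ⟨ENNReal.mul_lt_top (by simp) (h1 j).2.2,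
    ENNReal.mul_lt_top (by simp) hj⟩)

/-- The indicator function of `(C, ∞)`. -/
def step (C t : ℝ) : ℝ := if C < t then 1 else 0

theorem step_nonneg (C t : ℝ) : 0 ≤ step C t := by unfold step; split_ifs <;> norm_num

theorem step_le_one (C t : ℝ) : step C t ≤ 1 := by unfold step; split_ifs <;> norm_num

theorem step_sq (C t : ℝ) : step C t ^ 2 = step C t := by unfold step; split_ifs <;> norm_num

theorem step_mul_posPart (C t : ℝ) : step C t * max (t - C) 0 = max (t - C) 0 := by
  unfold step
  split_ifs with h
  · simp
  · rw [max_eq_right (by linarith), mul_zero]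

theorem measurable_step (C : ℝ) : Measurable (step C) :=
  Measurable.ite measurableSet_Ioi measurable_const measurable_const

theorem tendsto_step {C t : ℝ} (h : t ≠ C) : Tendsto (step C) (𝓝 t) (𝓝 (step C t)) := by
  refine tendsto_const_nhds.congr' ?_
  rcases lt_or_gt_of_ne h with h | h
  · filter_upwards [gt_mem_nhds h] with s hs
    simp [step, not_lt.2 h.le, not_lt.2 hs.le]
  · filter_upwards [lt_mem_nhds h] with s hs
    simp [step, h, hs]

/-- The gradient of `η (u - C)₊` when `u` has gradient `G`. -/
def truncGrad (η u : Eucl n → ℝ) (G : Eucl n → Eucl n) (C : ℝ) (x : Eucl n) : Eucl n :=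
  (η x * step C (u x)) • G x + max (u x - C) 0 • gradient η x

theorem abs_posPart_sub_le (a b C : ℝ) : |max (a - C) 0 - max (b - C) 0| ≤ |a - b| := by
  refine (abs_max_sub_max_le_abs _ _ _).trans (le_of_eq ?_)
  congr 1; ring

theorem aestronglyMeasurable_truncGrad {μ : Measure (Eucl n)} {η u : Eucl n → ℝ}
    {G : Eucl n → Eucl n} (hη : Continuous η) (hu : AEStronglyMeasurable u μ)
    (hG : AEStronglyMeasurable G μ) (C : ℝ) :
    AEStronglyMeasurable (truncGrad η u G C) μ := by
  have h1 : AEMeasurable (fun x => step C (u x)) μ :=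
    (measurable_step C).comp_aemeasurable hu.aemeasurable
  have h2 : AEMeasurable (fun x => max (u x - C) 0) μ :=
    (hu.aemeasurable.sub_const C).max aemeasurable_const
  exact ((hη.aemeasurable.mul h1).aestronglyMeasurable.smul hG).add
    (h2.aestronglyMeasurable.smul (measurable_gradient η).aestronglyMeasurable)

/-- The gradient error splits into `η` times the error of the gradients, `G` times the difference of
the two indicator functions, and `∇η` times the difference of the truncations. The hypothesis `u ≠
C` a.e. is what makes the indicators converge. -/
theorem SobolevLimit.mul_posPart {A S : Eucl n → Matrix (Fin n) (Fin n) ℝ} {Ω : Set (Eucl n)}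
    {w : Eucl n → ℝ≥0} {c₀ C₀ : ℝ} (hΩ : IsOpen Ω) (hA : IsCoefficient Ω w A S c₀ C₀)
    {vj : ℕ → Eucl n → ℝ} {u : Eucl n → ℝ} {G : Eucl n → Eucl n}
    (hvj : ∀ j, LocallyLipschitzOn Ω (vj j)) (h : SobolevLimit A Ω vj u G)
    (hae : ∀ᵐ x ∂volume.restrict Ω, Tendsto (fun j => vj j x) atTop (𝓝 (u x)))
    (hG : energy A Ω G < ∞) {η : Eucl n → ℝ} (hη : LipC Ω η) {C : ℝ}
    (hC : ∀ᵐ x ∂volume.restrict Ω, u x ≠ C) :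
    SobolevLimit A Ω (fun j x => η x * max (vj j x - C) 0) (fun x => η x * max (u x - C) 0)
      (truncGrad η u G C) := by
  obtain ⟨⟨L, hL⟩, hc, -⟩ := hη
  obtain ⟨b, hb⟩ := hc.exists_bound_of_continuous hL.continuous
  have hb2 : ∀ x, η x ^ 2 ≤ b ^ 2 := fun x => sq_le_sq' (abs_le.1 (hb x)).1 (abs_le.1 (hb x)).2
  obtain ⟨M, hM⟩ := hA.bounded
  have hum := h.meas.aemeasurable
  have hvm : ∀ j, AEMeasurable (vj j) (volume.restrict Ω) := fun j =>
    ((hvj j).continuousOn.aestronglyMeasurable hΩ.measurableSet).aemeasurable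
  refine ⟨(hL.continuous.aemeasurable.mul
    ((hum.sub_const C).max aemeasurable_const)).aestronglyMeasurable,
    aestronglyMeasurable_truncGrad hL.continuous h.meas h.meas_grad C, ?_, ?_⟩
  · have h1 := ENNReal.Tendsto.const_mul h.tendsto
      (Or.inr (ENNReal.ofReal_ne_top (r := b ^ 2)))
    rw [mul_zero] at h1
    refine tendsto_of_tendsto_of_tendsto_of_le_of_le tendsto_const_nhds h1
      (fun _ => zero_le) fun j => ?_
    simp only []
    rw [← lintegral_const_mul' _ _ ENNReal.ofReal_ne_top]
    refine lintegral_mono fun x => ?_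
    rw [← ENNReal.ofReal_mul (sq_nonneg b)]
    refine ENNReal.ofReal_le_ofReal ?_
    rw [← mul_sub, mul_pow]
    exact mul_le_mul (hb2 x) (sq_le_sq.2 (abs_posPart_sub_le _ _ C)) (sq_nonneg _) (sq_nonneg b)
  · set c : ℝ := |n ^ 2 * M * L ^ 2| with hcdef
    let D : ℕ → Eucl n → ℝ := fun j x => (step C (vj j x) - step C (u x)) ^ 2 * quad (A x) (G x)
    have hDm : ∀ j, AEMeasurable (D j) (volume.restrict Ω) := fun j =>
      ((((measurable_step C).comp_aemeasurable (hvm j)).sub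
        ((measurable_step C).comp_aemeasurable hum)).pow_const 2).mul
        (aemeasurable_quad hA.measurable h.meas_grad)
    -- Dominated convergence with the integrable majorant `Gᵗ A G`.
    have hD : Tendsto (fun j => ∫⁻ x in Ω, ENNReal.ofReal (D j x)) atTop (𝓝 0) := by
      have := tendsto_lintegral_of_dominated_convergence' (μ := volume.restrict Ω)
        (F := fun j x => ENNReal.ofReal (D j x)) (f := fun _ => 0)
        (fun x => ENNReal.ofReal (quad (A x) (G x))) (fun j => (hDm j).ennreal_ofReal)
        (fun j => ?_) hG.ne ?_
      · simpa using this
      · filter_upwards [hA.posSemidef] with x hx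
        refine ENNReal.ofReal_le_ofReal (mul_le_of_le_one_left (quad_nonneg hx _) ?_)
        have := step_nonneg C (vj j x); have := step_le_one C (vj j x)
        have := step_nonneg C (u x); have := step_le_one C (u x)
        nlinarith
      · filter_upwards [hae, hC] with x hx hxC
        have h1 : Tendsto (fun j => step C (vj j x)) atTop (𝓝 (step C (u x))) :=
          (tendsto_step hxC).comp hx
        have h2 := ((h1.sub_const (step C (u x))).pow 2).mul_const (quad (A x) (G x))
        rw [sub_self, zero_pow two_ne_zero, zero_mul] at h2
        simpa using ENNReal.tendsto_ofReal h2
    have h1 := ((ENNReal.Tendsto.const_mul h.tendsto_grad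
      (Or.inr (ENNReal.ofReal_ne_top (r := 4 * b ^ 2)))).add
      (ENNReal.Tendsto.const_mul hD (Or.inr (ENNReal.ofReal_ne_top (r := 4 * b ^ 2))))).add
      (ENNReal.Tendsto.const_mul h.tendsto (Or.inr (ENNReal.ofReal_ne_top (r := 2 * c))))
    simp only [mul_zero, add_zero] at h1
    refine tendsto_of_tendsto_of_tendsto_of_le_of_le tendsto_const_nhds h1
      (fun _ => zero_le) fun j => ?_
    have hm1 : AEMeasurable (fun x => ENNReal.ofReal (quad (A x) (gradient (vj j) x - G x)))
        (volume.restrict Ω) := (aemeasurable_quad hA.measurable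
        ((measurable_gradient _).aestronglyMeasurable.sub h.meas_grad)).ennreal_ofReal
    simp only [energy_eq]
    rw [← lintegral_const_mul' _ _ ENNReal.ofReal_ne_top,
      ← lintegral_const_mul' _ _ ENNReal.ofReal_ne_top,
      ← lintegral_const_mul' _ _ ENNReal.ofReal_ne_top,
      ← lintegral_add_left' (hm1.const_mul _),
      ← lintegral_add_left' ((hm1.const_mul _).fun_add ((hDm j).ennreal_ofReal.const_mul _))]
    refine lintegral_mono_ae ?_
    filter_upwards [hA.posSemidef, hM,
      ae_differentiableAt_of_locallyLipschitzOn hΩ (hvj j),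
      ae_differentiableAt_of_locallyLipschitzOn hΩ
        (LocallyLipschitzOn.posPart_sub (hvj j) C),
      ae_restrict_of_ae hL.ae_differentiableAt] with x hx hMx hd1 hd2 hd3
    have hg : gradient (fun y => η y * max (vj j y - C) 0) x - truncGrad η u G C x =
        ((η x * step C (vj j x)) • (gradient (vj j) x - G x) +
          (η x * (step C (vj j x) - step C (u x))) • G x) +
          (max (vj j x - C) 0 - max (u x - C) 0) • gradient η x := by
      rw [gradient_mul hd3 hd2, gradient_posPart_sub hd1.continuousAt, truncGrad]
      unfold step
      split_ifs <;> module
    have hq0 := quad_nonneg hx (gradient (vj j) x - G x)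
    have hD0 : 0 ≤ D j x := mul_nonneg (sq_nonneg _) (quad_nonneg hx _)
    have hcb : quad (A x) (gradient η x) ≤ c := by
      refine (quad_le_of_bound hMx _).trans ?_
      have h2 : ‖gradient η x‖ ^ 2 ≤ L ^ 2 := by
        gcongr; exact norm_gradient_le hL x
      have hM0 : 0 ≤ n ^ 2 * M := by
        rcases Nat.eq_zero_or_pos n with h0 | h0
        · simp [h0]
        · exact mul_nonneg (by positivity) ((abs_nonneg _).trans (hMx ⟨0, h0⟩ ⟨0, h0⟩))
      exact (mul_le_mul_of_nonneg_left h2 hM0).trans (le_abs_self _)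
    rw [← ENNReal.ofReal_mul (by positivity), ← ENNReal.ofReal_mul (by positivity),
      ← ENNReal.ofReal_mul (by positivity), ← ENNReal.ofReal_add (by positivity) (by positivity),
      ← ENNReal.ofReal_add (by positivity) (by positivity)]
    refine ENNReal.ofReal_le_ofReal ?_
    rw [hg]
    refine (quad_add_le hx _ _).trans ?_
    have h2 := quad_add_le hx ((η x * step C (vj j x)) • (gradient (vj j) x - G x))
      ((η x * (step C (vj j x) - step C (u x))) • G x)
    rw [quad_smul, quad_smul, mul_pow, mul_pow, step_sq] at h2
    rw [quad_smul]
    have h3 : (max (vj j x - C) 0 - max (u x - C) 0) ^ 2 * quad (A x) (gradient η x) ≤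
        (vj j x - u x) ^ 2 * c :=
      mul_le_mul (sq_le_sq.2 (abs_posPart_sub_le _ _ C)) hcb (quad_nonneg hx _) (sq_nonneg _)
    have h4 : η x ^ 2 * step C (vj j x) * quad (A x) (gradient (vj j) x - G x) ≤
        b ^ 2 * quad (A x) (gradient (vj j) x - G x) := by
      refine mul_le_mul_of_nonneg_right ?_ hq0
      exact (mul_le_of_le_one_right (sq_nonneg _) (step_le_one _ _)).trans (hb2 x)
    have h5 : η x ^ 2 * (step C (vj j x) - step C (u x)) ^ 2 * quad (A x) (G x) ≤
        b ^ 2 * D j x := by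
      rw [mul_assoc]
      exact mul_le_mul_of_nonneg_right (hb2 x) hD0
    linarith

/-- The two sets `U ⊆ V` allow the same truncation to be used as a test function on all of `Ω` and
as a competitor in the norm `X` on the ball. -/
theorem memWAZero_mul_posPart {A S : Eucl n → Matrix (Fin n) (Fin n) ℝ} {Ω U V : Set (Eucl n)}
    {w : Eucl n → ℝ≥0} {c₀ C₀ : ℝ} (hΩ : IsOpen Ω) (hA : IsCoefficient Ω w A S c₀ C₀)
    {u : Eucl n → ℝ} {G : Eucl n → Eucl n} (h : MemWA A Ω u G) (hUV : U ⊆ V) (hV : V ⊆ Ω)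
    {η : Eucl n → ℝ} (hη : LipC U η) {C : ℝ} (hC : ∀ᵐ x ∂volume.restrict Ω, u x ≠ C) :
    MemWAZero A V (fun x => η x * max (u x - C) 0) (truncGrad η u G C) := by
  obtain ⟨vj, h1, h2, h3⟩ := h.exists_approx hΩ
  refine ⟨fun j x => η x * max (vj j x - C) 0, fun j => ?_,
    (h2.mul_posPart hΩ hA h1 h3 (h.energy_lt_top hA.measurable hA.posSemidef)
      (hη.mono (hUV.trans hV)) hC).mono hV⟩
  exact (hη.mono hUV).mul_of_locallyLipschitzOn hV (LocallyLipschitzOn.posPart_sub (h1 j) C)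

end Sobolev

/-! ### The Caccioppoli inequality -/

section Caccioppoli

variable {n : ℕ}

theorem abs_integral_le_xNorm {A S : Eucl n → Matrix (Fin n) (Fin n) ℝ} {U : Set (Eucl n)}
    {w : Eucl n → ℝ≥0} {f v : Eucl n → ℝ} {G : Eucl n → Eucl n}
    (hf : IsAdmissibleOn w A S U f) (hv : MemWAZero A U v G) {m e : ℝ} (hm : 0 ≤ m) (he : 0 ≤ e)
    (hvm : wMeasure w {y | y ∈ U ∧ v y ≠ 0} ≤ ENNReal.ofReal m)
    (hG : ∫⁻ x in U, ENNReal.ofReal (‖mulE (S x) (G x)‖ ^ 2) ≤ ENNReal.ofReal e) :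
    |∫ x in U, v x * f x| ≤ (xNorm w A S U f).toReal * (√m * √e) := by
  have hX := hf.2.ne
  have h1 : ENNReal.ofReal |∫ x in U, v x * f x| /
      (wMeasure w {y | y ∈ U ∧ v y ≠ 0} ^ (1 / 2 : ℝ) * gradNorm S U G) ≤ xNorm w A S U f :=
    le_iSup_of_le v (le_iSup_of_le G (le_iSup_of_le hv le_rfl))
  have hp : (0 : ℝ) ≤ 1 / 2 := by norm_num
  have h2 : wMeasure w {y | y ∈ U ∧ v y ≠ 0} ^ (1 / 2 : ℝ) ≤ ENNReal.ofReal √m := by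
    refine (ENNReal.rpow_le_rpow hvm hp).trans (le_of_eq ?_)
    rw [ENNReal.ofReal_rpow_of_nonneg hm hp, Real.sqrt_eq_rpow]
  have h3 : gradNorm S U G ≤ ENNReal.ofReal √e := by
    refine (ENNReal.rpow_le_rpow hG hp).trans (le_of_eq ?_)
    rw [ENNReal.ofReal_rpow_of_nonneg he hp, Real.sqrt_eq_rpow]
  set D := wMeasure w {y | y ∈ U ∧ v y ≠ 0} ^ (1 / 2 : ℝ) * gradNorm S U G
  have hD : D ≤ ENNReal.ofReal √m * ENNReal.ofReal √e := mul_le_mul' h2 h3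
  have hDt : D ≠ ∞ := (hD.trans_lt (ENNReal.mul_lt_top ENNReal.ofReal_lt_top
    ENNReal.ofReal_lt_top)).ne
  -- A vanishing denominator is harmless: `c / 0 = ∞` for `c > 0`, so finiteness of the norm forces
  -- the integral to vanish.
  have h4 : ENNReal.ofReal |∫ x in U, v x * f x| ≤ xNorm w A S U f * D :=
    (ENNReal.div_le_iff_le_mul (Or.inr hX) (Or.inl hDt)).1 h1
  refine (ENNReal.ofReal_le_ofReal_iff (by positivity)).1 (h4.trans ?_)
  rw [ENNReal.ofReal_mul ENNReal.toReal_nonneg, ENNReal.ofReal_toReal hX,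
    ENNReal.ofReal_mul (Real.sqrt_nonneg m)]
  exact mul_le_mul_right hD _

/-- Test with `ψ² (u - C)₊`. Let `I` be the integral of `ψ² ∇uᵗ A ∇u` over `{u > C}` and `Q` that of
`(u - C)₊² ∇ψᵗ A ∇ψ`. Completing squares bounds the bilinear side by `-I/2 + 2Q`. The source term is
bounded through the norm `X`, whose factor `‖∇_A g‖` again involves `I`; Young's inequality absorbs
it. The result `I ≤ 12 Q + 8 C₀ X² m` gives the constants `26` and `16`. -/
theorem caccioppoli {A S : Eucl n → Matrix (Fin n) (Fin n) ℝ} {Ω B : Set (Eucl n)}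
    {w : Eucl n → ℝ≥0} {c₀ C₀ : ℝ} (hC₀ : 0 < C₀) (hΩ : IsOpen Ω)
    (hA : IsCoefficient Ω w A S c₀ C₀) {f u : Eucl n → ℝ} {Gu : Eucl n → Eucl n}
    (hu : MemWA A Ω u Gu)
    (hsub : ∀ (g : Eucl n → ℝ) (Gg : Eucl n → Eucl n), MemWAZero A Ω g Gg →
      (∀ᵐ x ∂volume.restrict Ω, 0 ≤ g x) → IntegrableOn (fun x => f x * g x) Ω →
      ∫ x in Ω, f x * g x ≤ -∫ x in Ω, inner ℝ (Gg x) (mulE (A x) (Gu x)))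
    (hBΩ : B ⊆ Ω) (hf : IsAdmissibleOn w A S B f)
    {ψ : Eucl n → ℝ} (hψ : LipC B ψ) (hψ0 : ∀ x, 0 ≤ ψ x) (hψ1 : ∀ x, ψ x ≤ 1)
    {C : ℝ} (hC : ∀ᵐ x ∂volume.restrict Ω, u x ≠ C) {m J : ℝ} (hm0 : 0 ≤ m)
    (hm : wMeasure w {y | ψ y ≠ 0 ∧ C < u y} ≤ ENNReal.ofReal m) (hJ0 : 0 ≤ J)
    (hJ : ∫⁻ x in Ω, ENNReal.ofReal (max (u x - C) 0 ^ 2 * quad (A x) (gradient ψ x)) ≤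
      ENNReal.ofReal J) :
    ∫⁻ x in Ω, ENNReal.ofReal (‖mulE (S x) (truncGrad ψ u Gu C x)‖ ^ 2) ≤
      ENNReal.ofReal (26 * C₀ * J + 16 * C₀ ^ 2 * (xNorm w A S B f).toReal ^ 2 * m) := by
  obtain ⟨vj, hvj, hlim, hae⟩ := hu.exists_approx hΩ
  have hum := hlim.meas.aemeasurable
  have hGm := hlim.meas_grad
  obtain ⟨L, hL⟩ := hψ.1
  have hstep : AEMeasurable (fun x => step C (u x)) (volume.restrict Ω) :=
    (measurable_step C).comp_aemeasurable hum
  have hvm : AEMeasurable (fun x => max (u x - C) 0) (volume.restrict Ω) :=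
    (hum.sub_const C).max aemeasurable_const
  have hGg := memWAZero_mul_posPart hΩ hA hu hBΩ subset_rfl hψ.sq hC
  have hGgB := memWAZero_mul_posPart hΩ hA hu subset_rfl hBΩ hψ.sq hC
  set g : Eucl n → ℝ := fun x => ψ x ^ 2 * max (u x - C) 0 with hg
  set Gg := truncGrad (fun x => ψ x ^ 2) u Gu C with hGgdef
  let a : Eucl n → ℝ := fun x => ψ x ^ 2 * step C (u x) * quad (A x) (Gu x)
  let q : Eucl n → ℝ := fun x => max (u x - C) 0 ^ 2 * quad (A x) (gradient ψ x)
  have hq0 : ∀ᵐ x ∂volume.restrict Ω, 0 ≤ q x := by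
    filter_upwards [hA.posSemidef] with x hx
    exact mul_nonneg (sq_nonneg _) (quad_nonneg hx _)
  have ha0 : ∀ᵐ x ∂volume.restrict Ω, 0 ≤ a x := by
    filter_upwards [hA.posSemidef] with x hx
    exact mul_nonneg (mul_nonneg (sq_nonneg _) (step_nonneg _ _)) (quad_nonneg hx _)
  have hqm : AEMeasurable q (volume.restrict Ω) := (hvm.pow_const 2).mul
    (aemeasurable_quad hA.measurable (measurable_gradient ψ).aestronglyMeasurable)
  have hqi : Integrable q (volume.restrict Ω) :=
    (lintegral_ofReal_ne_top_iff_integrable hqm.aestronglyMeasurable hq0).1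
      (hJ.trans_lt ENNReal.ofReal_lt_top).ne
  have hGui : Integrable (fun x => quad (A x) (Gu x)) (volume.restrict Ω) := by
    refine (lintegral_ofReal_ne_top_iff_integrable
      (aemeasurable_quad hA.measurable hGm).aestronglyMeasurable ?_).1
      (hu.energy_lt_top hA.measurable hA.posSemidef).ne
    filter_upwards [hA.posSemidef] with x hx using quad_nonneg hx _
  have hψsq : ∀ x, ψ x ^ 2 ≤ 1 := fun x => pow_le_one₀ (hψ0 x) (hψ1 x)
  have hai : Integrable a (volume.restrict Ω) := by
    refine hGui.mono' (((hL.continuous.aemeasurable.pow_const 2).mul hstep).mul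
      (aemeasurable_quad hA.measurable hGm)).aestronglyMeasurable ?_
    filter_upwards [hA.posSemidef, ha0] with x hx hax
    rw [Real.norm_of_nonneg hax]
    exact mul_le_of_le_one_left (quad_nonneg hx _)
      (mul_le_one₀ (hψsq x) (step_nonneg _ _) (step_le_one _ _))
  have hJ' : ∫ x in Ω, q x ≤ J := by
    rw [← ofReal_integral_eq_lintegral_ofReal hqi hq0] at hJ
    exact (ENNReal.ofReal_le_ofReal_iff hJ0).1 hJ
  have hI0 : 0 ≤ ∫ x in Ω, a x := integral_nonneg_of_ae ha0
  -- the gradient of the test function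
  have hgrad : ∀ᵐ x ∂volume.restrict Ω, Gg x =
      ψ x • (ψ x * step C (u x)) • Gu x + (2 * ψ x) • max (u x - C) 0 • gradient ψ x := by
    filter_upwards [ae_restrict_of_ae hL.ae_differentiableAt] with x hx
    have h1 : gradient (fun y => ψ y ^ 2) x = (2 * ψ x) • gradient ψ x := by
      simp_rw [pow_two]
      rw [gradient_mul hx hx]
      module
    rw [hGgdef, truncGrad, h1]
    module
  have hqGu : ∀ x, quad (A x) ((ψ x * step C (u x)) • Gu x) = a x := fun x => by
    rw [quad_smul, mul_pow, step_sq]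
  have hqψ : ∀ x, quad (A x) (max (u x - C) 0 • gradient ψ x) = q x := fun x => quad_smul _ _
  have hquadGg : ∀ᵐ x ∂volume.restrict Ω, quad (A x) (Gg x) ≤ 2 * a x + 8 * q x := by
    filter_upwards [hgrad, hA.posSemidef, ha0, hq0] with x hx hAx hax hqx
    rw [hx]
    refine (quad_add_le hAx _ _).trans ?_
    rw [quad_smul (ψ x), quad_smul (2 * ψ x), hqGu, hqψ, mul_pow]
    have := mul_le_of_le_one_left hax (hψsq x)
    have := mul_le_of_le_one_left hqx (hψsq x)
    linarith
  have hcomb : ∀ s t : ℝ, Integrable (fun x => C₀ * (s * a x + t * q x)) (volume.restrict Ω) :=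
    fun s t => ((hai.const_mul s).add (hqi.const_mul t)).const_mul C₀
  have hGgm : AEStronglyMeasurable Gg (volume.restrict Ω) :=
    aestronglyMeasurable_truncGrad (hL.continuous.pow 2) hlim.meas hGm C
  have hinner : Integrable (fun x => inner ℝ (Gg x) (mulE (A x) (Gu x)))
      (volume.restrict Ω) := by
    refine (((hai.const_mul 2).add (hqi.const_mul 8)).add hGui).mono'
      (aemeasurable_inner_mulE hA.measurable hGgm hGm).aestronglyMeasurable ?_
    filter_upwards [hA.posSemidef, hquadGg] with x hx hxG
    simp only [Pi.add_apply, Real.norm_eq_abs, abs_le]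
    have h1 := quad_nonneg hx (Gg x)
    have h2 := quad_nonneg hx (Gu x)
    constructor
    · linarith [neg_two_mul_inner_mulE_le hx (Gg x) (Gu x)]
    · linarith [two_mul_inner_mulE_le hx (Gg x) (Gu x)]
  have hupper : -∫ x in Ω, inner ℝ (Gg x) (mulE (A x) (Gu x)) ≤
      -(1 / 2) * (∫ x in Ω, a x) + 2 * ∫ x in Ω, q x := by
    rw [← integral_neg, ← integral_const_mul, ← integral_const_mul,
      ← integral_add (hai.const_mul _) (hqi.const_mul _)]
    refine integral_mono_ae hinner.neg ((hai.const_mul _).add (hqi.const_mul _)) ?_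
    filter_upwards [hgrad, hA.posSemidef] with x hx hAx
    have h1 := neg_two_mul_inner_mulE_le hAx ((2 : ℝ) • max (u x - C) 0 • gradient ψ x)
      ((ψ x * step C (u x)) • Gu x)
    rw [quad_smul, hqGu, hqψ] at h1
    have h2 : inner ℝ (Gg x) (mulE (A x) (Gu x)) = a x +
        inner ℝ ((2 : ℝ) • max (u x - C) 0 • gradient ψ x)
          (mulE (A x) ((ψ x * step C (u x)) • Gu x)) := by
      simp only [hx, a, quad, mulE_smul, inner_add_left, inner_smul_left, inner_smul_right,
        conj_trivial]
      linear_combination (-2 * ψ x * inner ℝ (gradient ψ x) (mulE (A x) (Gu x))) *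
        step_mul_posPart C (u x)
    rw [h2]
    linarith
  -- the right-hand side
  have hsupp : ∀ x ∈ Ω \ B, f x * g x = 0 := fun x hx => by
    have : ψ x = 0 := image_eq_zero_of_notMem_tsupport fun h => hx.2 (hψ.2.2 h)
    simp [hg, this]
  -- Admissibility gives integrability on `B` only; the cutoff makes the product vanish on the rest
  -- of `Ω`.
  have hfg : IntegrableOn (fun x => f x * g x) B := by
    simpa only [mul_comm] using hf.1 g Gg hGgB
  have hsub' := hsub g Gg hGg (Eventually.of_forall fun x =>
    mul_nonneg (sq_nonneg _) (le_max_right _ _)) (hfg.of_forall_sdiff_eq_zero hΩ.measurableSet hsupp)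
  rw [setIntegral_eq_of_subset_of_forall_sdiff_eq_zero hΩ.measurableSet hBΩ hsupp] at hsub'
  set I := ∫ x in Ω, a x with hI
  set Q := ∫ x in Ω, q x with hQ
  have hQ0 : 0 ≤ Q := integral_nonneg_of_ae hq0
  have hSGg : ∫⁻ x in B, ENNReal.ofReal (‖mulE (S x) (Gg x)‖ ^ 2) ≤
      ENNReal.ofReal (C₀ * (2 * I + 8 * Q)) := by
    have he : C₀ * (2 * I + 8 * Q) = ∫ x in Ω, C₀ * (2 * a x + 8 * q x) := by
      rw [integral_const_mul, integral_add (hai.const_mul _) (hqi.const_mul _),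
        integral_const_mul, integral_const_mul]
    rw [he, ofReal_integral_eq_lintegral_ofReal (hcomb 2 8) (by
      filter_upwards [ha0, hq0] with x h1 h2
      exact mul_nonneg hC₀.le (add_nonneg (by linarith) (by linarith)))]
    refine (lintegral_mono_set hBΩ).trans (lintegral_mono_ae ?_)
    filter_upwards [hA.upper, hquadGg] with x hx hxG
    exact ENNReal.ofReal_le_ofReal ((hx _).trans (mul_le_mul_of_nonneg_left hxG hC₀.le))
  have hgset : wMeasure w {y | y ∈ B ∧ g y ≠ 0} ≤ ENNReal.ofReal m := by
    refine le_trans (measure_mono fun y hy => ?_) hm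
    refine ⟨fun h0 => hy.2 (by simp [hg, h0]), ?_⟩
    by_contra hlt
    refine hy.2 ?_
    simp only [hg]
    rw [max_eq_right (by linarith [not_lt.1 hlt]), mul_zero]
  have hE0 : 0 ≤ C₀ * (2 * I + 8 * Q) := by positivity
  have hX := abs_integral_le_xNorm hf hGgB hm0 hE0 hgset hSGg
  simp_rw [mul_comm (g _) (f _)] at hX
  set X := (xNorm w A S B f).toReal
  -- The weight `4 C₀` in the square leaves exactly `I/4`, half of the coercive term `I/2`.
  have hyoung : X * (√m * √(C₀ * (2 * I + 8 * Q))) ≤ 2 * C₀ * X ^ 2 * m + I / 4 + Q := by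
    have h1 := sq_nonneg (4 * C₀ * (X * √m) - √(C₀ * (2 * I + 8 * Q)))
    have h2 := Real.sq_sqrt hm0
    have h3 := Real.sq_sqrt hE0
    have h4 : 0 ≤ 8 * C₀ * (2 * C₀ * X ^ 2 * m + I / 4 + Q -
        X * (√m * √(C₀ * (2 * I + 8 * Q)))) := by
      have e : (4 * C₀ * (X * √m) - √(C₀ * (2 * I + 8 * Q))) ^ 2 =
        16 * C₀ ^ 2 * X ^ 2 * √m ^ 2 - 8 * C₀ * (X * (√m * √(C₀ * (2 * I + 8 * Q)))) +
          √(C₀ * (2 * I + 8 * Q)) ^ 2 := by ring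
      rw [e, h2, h3] at h1
      linarith
    have := nonneg_of_mul_nonneg_right h4 (by positivity)
    linarith
  have hIQ : I ≤ 12 * Q + 8 * C₀ * X ^ 2 * m := by
    linarith [neg_abs_le (∫ x in B, f x * g x)]
  -- conclusion
  calc ∫⁻ x in Ω, ENNReal.ofReal (‖mulE (S x) (truncGrad ψ u Gu C x)‖ ^ 2)
      ≤ ∫⁻ x in Ω, ENNReal.ofReal (C₀ * (2 * a x + 2 * q x)) := by
        refine lintegral_mono_ae ?_
        filter_upwards [hA.upper, hA.posSemidef] with x hx hAx
        refine ENNReal.ofReal_le_ofReal ((hx _).trans (mul_le_mul_of_nonneg_left ?_ hC₀.le))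
        refine (quad_add_le hAx _ _).trans ?_
        rw [hqGu, hqψ]
    _ = ENNReal.ofReal (∫ x in Ω, C₀ * (2 * a x + 2 * q x)) := by
        refine (ofReal_integral_eq_lintegral_ofReal (hcomb 2 2) ?_).symm
        filter_upwards [ha0, hq0] with x h1 h2
        exact mul_nonneg hC₀.le (add_nonneg (by linarith) (by linarith))
    _ ≤ _ := by
        refine ENNReal.ofReal_le_ofReal ?_
        rw [integral_const_mul, integral_add (hai.const_mul _) (hqi.const_mul _),
          integral_const_mul, integral_const_mul, ← hI, ← hQ]
        have h1 : C₀ * (2 * I + 2 * Q) ≤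
            C₀ * (2 * (12 * J + 8 * C₀ * X ^ 2 * m) + 2 * J) := by gcongr; linarith
        linarith

end Caccioppoli

/-! ### Consequences of the Orlicz–Sobolev inequality -/

section Orlicz

variable {n : ℕ}

theorem luxemburgNorm_lt_ofReal {S : Eucl n → Matrix (Fin n) (Fin n) ℝ} {U : Set (Eucl n)}
    {w : Eucl n → ℝ≥0} {Φ φ : ℝ → ℝ} {CS ρ W e a : ℝ} (hOS : OrliczSobolevOn Φ w S U CS φ ρ)
    (hφ : 0 < CS * φ ρ) (hW : 0 < W) (hWU : wMeasure w U = ENNReal.ofReal W) (he : 0 ≤ e)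
    (ha : 0 < a) (hea : (CS * φ ρ) ^ 2 * e < a ^ 2 * W) {v : Eucl n → ℝ} (hv : LipC U v)
    (hG : ∫⁻ x in U, ENNReal.ofReal (‖mulE (S x) (gradient v x)‖ ^ 2) ≤ ENNReal.ofReal e) :
    luxemburgNorm Φ ((wMeasure w U)⁻¹ • (wMeasure w).restrict U) v < ENNReal.ofReal a := by
  have hp : (0 : ℝ) ≤ 1 / 2 := by norm_num
  refine (hOS v hv).trans_lt ?_
  have h3 : gradNorm S U (gradient v) ≤ ENNReal.ofReal √e := by
    refine (ENNReal.rpow_le_rpow hG hp).trans (le_of_eq ?_)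
    rw [ENNReal.ofReal_rpow_of_nonneg he hp, Real.sqrt_eq_rpow]
  have hW' : 0 < √W := Real.sqrt_pos.2 hW
  rw [hWU, ENNReal.ofReal_rpow_of_nonneg hW.le hp, ← Real.sqrt_eq_rpow,
    ← ENNReal.ofReal_div_of_pos hW']
  refine (mul_le_mul_right h3 _).trans_lt ?_
  rw [← ENNReal.ofReal_mul (by positivity)]
  refine (ENNReal.ofReal_lt_ofReal_iff ha).2 ?_
  rw [div_mul_eq_mul_div, div_lt_iff₀ hW']
  refine lt_of_pow_lt_pow_left₀ 2 (by positivity) ?_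
  rwa [mul_pow _ √e, mul_pow _ √W, Real.sq_sqrt he, Real.sq_sqrt hW.le]

/-- A norm below `a` provides some `b < a` with `∫ Φ(|v|/b) ≤ 1`; the pointwise lower bound for `Φ`
at `t = |v|/b` then yields the claim for every admissible `s`. -/
theorem lintegral_sq_sub_le_of_luxemburgNorm_lt {U : Set (Eucl n)} {w : Eucl n → ℝ≥0} {k : ℕ}
    {N W a s : ℝ} (hN : 1 < N) (hW : 0 < W) (hWU : wMeasure w U = ENNReal.ofReal W)
    (hs : threshold k N ≤ s) {v : Eucl n → ℝ}
    (h : luxemburgNorm (youngPhi k N) ((wMeasure w U)⁻¹ • (wMeasure w).restrict U) v <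
      ENNReal.ofReal a) :
    ∫⁻ x in U, ENNReal.ofReal (v x ^ 2 - s * a ^ 2) ∂wMeasure w ≤
      ENNReal.ofReal (a ^ 2 * W / logFactor k N s) := by
  obtain ⟨b, h⟩ := iInf_lt_iff.1 h
  obtain ⟨hb, h⟩ := iInf_lt_iff.1 h
  obtain ⟨hint, hba⟩ := iInf_lt_iff.1 h
  have hb0 : (0 : ℝ) < b := hb
  have hba' : (b : ℝ) < a := by
    rw [← ENNReal.ofReal_coe_nnreal] at hba
    exact (ENNReal.ofReal_lt_ofReal_iff'.1 hba).1
  have hs0 : 0 ≤ s := by linarith [one_le_threshold (k := k) hN]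
  have hh := logFactor_pos hN hs
  have hW0 : ENNReal.ofReal W ≠ 0 := by simpa using hW
  rw [lintegral_smul_measure, hWU, smul_eq_mul, mul_comm, ← div_eq_mul_inv,
    ENNReal.div_le_iff hW0 ENNReal.ofReal_ne_top, one_mul] at hint
  calc ∫⁻ x in U, ENNReal.ofReal (v x ^ 2 - s * a ^ 2) ∂wMeasure w
      ≤ ∫⁻ x in U, ENNReal.ofReal (a ^ 2 / logFactor k N s) *
          ENNReal.ofReal (youngPhi k N (|v x| / b)) ∂wMeasure w := by
        refine lintegral_mono fun x => ?_
        rw [← ENNReal.ofReal_mul (by positivity)]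
        refine ENNReal.ofReal_le_ofReal ?_
        have h1 := sub_mul_logFactor_le_youngPhi hN hs (|v x| / b)
        have h2 := youngPhi_nonneg (k := k) hN (|v x| / b)
        have hab : (b : ℝ) ^ 2 ≤ a ^ 2 := by gcongr
        rw [div_pow, sq_abs] at h1
        rw [div_mul_eq_mul_div, le_div_iff₀ hh]
        calc (v x ^ 2 - s * a ^ 2) * logFactor k N s
            ≤ (v x ^ 2 - s * b ^ 2) * logFactor k N s := by gcongr
          _ = b ^ 2 * ((v x ^ 2 / b ^ 2 - s) * logFactor k N s) := by field_simp
          _ ≤ b ^ 2 * youngPhi k N (|v x| / b) := by gcongr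
          _ ≤ a ^ 2 * youngPhi k N (|v x| / b) := by gcongr
    _ = ENNReal.ofReal (a ^ 2 / logFactor k N s) *
          ∫⁻ x in U, ENNReal.ofReal (youngPhi k N (|v x| / b)) ∂wMeasure w :=
        lintegral_const_mul' _ _ ENNReal.ofReal_ne_top
    _ ≤ ENNReal.ofReal (a ^ 2 / logFactor k N s) * ENNReal.ofReal W := by gcongr
    _ = _ := by rw [← ENNReal.ofReal_mul (by positivity), div_mul_eq_mul_div]

theorem restrict_wMeasure_absolutelyContinuous (w : Eucl n → ℝ≥0) (U : Set (Eucl n)) :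
    (wMeasure w).restrict U ≪ volume.restrict U :=
  (withDensity_absolutelyContinuous _ _).restrict U

/-- The Orlicz–Sobolev inequality bounds the `L²` norm of a function in `(W_A^{1,2})₀(U)` by its
energy, with a gain if the function has small support. -/
theorem lintegral_sq_le_of_orliczSobolev {A S : Eucl n → Matrix (Fin n) (Fin n) ℝ}
    {Ω U : Set (Eucl n)} {w : Eucl n → ℝ≥0} {c₀ C₀ : ℝ} (hΩ : IsOpen Ω)
    (hA : IsCoefficient Ω w A S c₀ C₀) (hUΩ : U ⊆ Ω) {k : ℕ} {N CS ρ W e a s m : ℝ}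
    {φ : ℝ → ℝ} (hN : 1 < N) (hOS : OrliczSobolevOn (youngPhi k N) w S U CS φ ρ)
    (hφ : 0 < CS * φ ρ) (hW : 0 < W) (hWU : wMeasure w U = ENNReal.ofReal W) (he : 0 ≤ e)
    (ha : 0 < a) (hea : (CS * φ ρ) ^ 2 * (2 * e) < a ^ 2 * W) (hs : threshold k N ≤ s)
    (hm0 : 0 ≤ m) {v : Eucl n → ℝ} {G : Eucl n → Eucl n} (hv : MemWAZero A U v G)
    (hm : wMeasure w {y | y ∈ U ∧ v y ≠ 0} ≤ ENNReal.ofReal m)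
    (hG : ∫⁻ x in U, ENNReal.ofReal (‖mulE (S x) (G x)‖ ^ 2) ≤ ENNReal.ofReal e) :
    ∫⁻ x in U, ENNReal.ofReal (v x ^ 2) ∂wMeasure w ≤
      ENNReal.ofReal (a ^ 2 * (s * m + W / logFactor k N s)) := by
  have hs0 : 0 ≤ s := by linarith [one_le_threshold (k := k) hN]
  have hh := logFactor_pos hN hs
  have hres : volume.restrict U ≤ volume.restrict Ω := Measure.restrict_mono_set _ hUΩ
  obtain ⟨vj, hlip, hlim⟩ := hv
  have hcont : ∀ j, Continuous (vj j) := fun j => by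
    obtain ⟨L, hL⟩ := (hlip j).1
    exact hL.continuous
  obtain ⟨ι, hι, hae⟩ := hlim.exists_subseq_ae fun j => (hcont j).aestronglyMeasurable
  have hlim' := hlim.comp hι.tendsto_atTop
  -- Splitting the gradient bounds the energies of the approximants by `2e` plus a null sequence;
  -- the strict inequality in `hea` leaves room for `e₁`.
  obtain ⟨e₁, he₁, hea₁⟩ : ∃ e₁, 2 * e < e₁ ∧ (CS * φ ρ) ^ 2 * e₁ < a ^ 2 * W := by
    obtain ⟨e₁, h1, h2⟩ := exists_between ((lt_div_iff₀' (by positivity)).2 hea)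
    exact ⟨e₁, h1, (lt_div_iff₀' (by positivity)).1 h2⟩
  have hSm : ∀ i j, AEMeasurable (fun x => S x i j) (volume.restrict U) := fun i j =>
    (hA.aemeasurable_sqrt hΩ i j).mono_measure hres
  have hSj : ∀ j, ∫⁻ x in U, ENNReal.ofReal (‖mulE (S x) (gradient (vj (ι j)) x)‖ ^ 2) ≤
      ENNReal.ofReal (2 * e) + ENNReal.ofReal (2 * C₀) *
        energy A U fun x => gradient (vj (ι j)) x - G x := by
    intro j
    have h1 : ENNReal.ofReal (2 * e) ≥
        2 * ∫⁻ x in U, ENNReal.ofReal (‖mulE (S x) (G x)‖ ^ 2) := by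
      rw [ENNReal.ofReal_mul two_pos.le, ENNReal.ofReal_ofNat]
      gcongr
    refine le_trans ?_ (add_le_add_left h1 _)
    rw [energy_eq, ← lintegral_const_mul' _ _ (by simp),
      ← lintegral_const_mul' _ _ ENNReal.ofReal_ne_top,
      ← lintegral_add_left' ((aemeasurable_norm_mulE_sq hSm
        hlim.meas_grad).ennreal_ofReal.const_mul 2)]
    refine lintegral_mono_ae ?_
    filter_upwards [ae_mono hres hA.upper, ae_mono hres hA.posSemidef] with x hx hAx
    have h2 := norm_mulE_add_sq_le (M := S x) (G x) (gradient (vj (ι j)) x - G x)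
    rw [add_sub_cancel] at h2
    refine (ofReal_le_two_mul_add (sq_nonneg _) (sq_nonneg _) h2).trans
      (add_le_add_right ?_ _)
    rw [ENNReal.ofReal_mul two_pos.le, ENNReal.ofReal_ofNat, mul_assoc,
      ← ENNReal.ofReal_mul' (quad_nonneg hAx _)]
    exact mul_le_mul_right (ENNReal.ofReal_le_ofReal (hx _)) 2
  have hev : ∀ᶠ j in atTop, ∫⁻ x in U,
      ENNReal.ofReal (‖mulE (S x) (gradient (vj (ι j)) x)‖ ^ 2) ≤ ENNReal.ofReal e₁ := by
    have h1 := (ENNReal.Tendsto.const_mul hlim'.tendsto_grad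
      (Or.inr (ENNReal.ofReal_ne_top (r := 2 * C₀)))).const_add (ENNReal.ofReal (2 * e))
    rw [mul_zero, add_zero] at h1
    filter_upwards [h1.eventually (gt_mem_nhds
      ((ENNReal.ofReal_lt_ofReal_iff (by linarith)).2 he₁))] with j hj
    exact (hSj j).trans hj.le
  -- The limit has small support but the approximants need not, so the limit is taken in the part
  -- above `s a²`, where supports play no role; the remaining part is at most `s a²` on the support
  -- of `v`.
  have hFatou : ∫⁻ x in U, ENNReal.ofReal (v x ^ 2 - s * a ^ 2) ∂wMeasure w ≤
      ENNReal.ofReal (a ^ 2 * W / logFactor k N s) := by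
    calc ∫⁻ x in U, ENNReal.ofReal (v x ^ 2 - s * a ^ 2) ∂wMeasure w
        ≤ ∫⁻ x in U, liminf (fun j => ENNReal.ofReal (vj (ι j) x ^ 2 - s * a ^ 2)) atTop
            ∂wMeasure w := by
          refine lintegral_mono_ae ?_
          filter_upwards [(restrict_wMeasure_absolutelyContinuous w U).ae_le hae] with x hx
          exact (ENNReal.tendsto_ofReal ((hx.pow 2).sub_const _)).liminf_eq.ge
      _ ≤ liminf (fun j => ∫⁻ x in U, ENNReal.ofReal (vj (ι j) x ^ 2 - s * a ^ 2)
            ∂wMeasure w) atTop :=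
          lintegral_liminf_le fun j =>
            (((hcont (ι j)).pow 2).sub continuous_const).measurable.ennreal_ofReal
      _ ≤ _ := by
          refine liminf_le_of_frequently_le' (hev.mono fun j hj => ?_).frequently
          exact lintegral_sq_sub_le_of_luxemburgNorm_lt hN hW hWU hs
            (luxemburgNorm_lt_ofReal hOS hφ hW hWU (by linarith) ha hea₁
              (hlip (ι j)) hj)
  have hvm : AEMeasurable v ((wMeasure w).restrict U) :=
    hlim.meas.aemeasurable.mono_ac (restrict_wMeasure_absolutelyContinuous w U)
  have hset : NullMeasurableSet {y | v y ≠ 0} ((wMeasure w).restrict U) :=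
    hvm.nullMeasurableSet_preimage (measurableSet_singleton (0 : ℝ)).compl
  calc ∫⁻ x in U, ENNReal.ofReal (v x ^ 2) ∂wMeasure w
      ≤ ∫⁻ x in U, (ENNReal.ofReal (v x ^ 2 - s * a ^ 2) +
          {y | v y ≠ 0}.indicator (fun _ => ENNReal.ofReal (s * a ^ 2)) x) ∂wMeasure w := by
        refine lintegral_mono fun x => ?_
        by_cases hx : v x = 0
        · simp [hx]
        · rw [Set.indicator_of_mem (by exact hx)]
          refine le_trans (ENNReal.ofReal_le_ofReal (le_of_eq ?_)) ENNReal.ofReal_add_le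
          ring
    _ = (∫⁻ x in U, ENNReal.ofReal (v x ^ 2 - s * a ^ 2) ∂wMeasure w) +
          ENNReal.ofReal (s * a ^ 2) * wMeasure w ({y | v y ≠ 0} ∩ U) := by
        rw [lintegral_add_left' ((hvm.pow_const 2).sub_const _).ennreal_ofReal,
          lintegral_indicator_const₀ hset, Measure.restrict_apply₀ hset]
    _ ≤ ENNReal.ofReal (a ^ 2 * W / logFactor k N s) +
          ENNReal.ofReal (s * a ^ 2) * ENNReal.ofReal m := by
        gcongr
        rwa [Set.inter_comm]
    _ = _ := by
        rw [← ENNReal.ofReal_mul (by positivity), ← ENNReal.ofReal_add (by positivity)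
          (by positivity)]
        congr 1; ring

end Orlicz

/-! ### The De Giorgi iteration -/

section Iteration

variable {n : ℕ}

theorem dball_mono {d : Eucl n → Eucl n → ℝ} {Ω : Set (Eucl n)} {x : Eucl n} {r r' : ℝ}
    (h : r ≤ r') : dball d Ω x r ⊆ dball d Ω x r' := fun _ hy => ⟨hy.1, hy.2.trans_le h⟩

theorem dball_subset (d : Eucl n → Eucl n → ℝ) (Ω : Set (Eucl n)) (x : Eucl n) (r : ℝ) :
    dball d Ω x r ⊆ Ω := fun _ hy => hy.1

/-- Only countably many values have a level set of positive measure, and each nonzero `ℓ i` excludes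
only countably many `T`. -/
theorem exists_null_level_sets {μ : Measure (Eucl n)} [SFinite μ] {u : Eucl n → ℝ}
    (hu : AEMeasurable u μ) {ℓ : ℕ → ℝ} (hℓ : ∀ i, ℓ i ≠ 0) {T₀ T₁ : ℝ} (hT : T₀ < T₁) :
    ∃ T, T₀ < T ∧ T < T₁ ∧ ∀ i, ∀ᵐ x ∂μ, u x ≠ ℓ i * T := by
  have h1 : {t : ℝ | 0 < μ {x | hu.mk u x = t}}.Countable :=
    Measure.countable_meas_level_set_pos hu.measurable_mk
  have h2 : (⋃ i, (fun T => ℓ i * T) ⁻¹' {t : ℝ | 0 < μ {x | hu.mk u x = t}}).Countable :=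
    Set.countable_iUnion fun i => h1.preimage (mul_right_injective₀ (hℓ i))
  obtain ⟨T, hT', hT1⟩ := (h2.dense_compl ℝ).exists_between hT
  refine ⟨T, hT1.1, hT1.2, fun i => ?_⟩
  simp only [Set.mem_compl_iff, Set.mem_iUnion, Set.mem_preimage, Set.mem_ofPred_eq, not_exists,
    not_lt, nonpos_iff_eq_zero] at hT'
  have h3 : ∀ᵐ x ∂μ, hu.mk u x ≠ ℓ i * T := by
    rw [ae_iff]; simpa using hT' i
  filter_upwards [h3, hu.ae_eq_mk] with x hx hx'
  rwa [hx']

theorem IsAdaptedRadii.lt {k : ℕ} {N r : ℝ} {ρ : ℕ → ℝ} (h : IsAdaptedRadii k N r ρ) (hk : 1 ≤ k)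
    (hN : 1 < N) (hr : 0 < r) {j : ℕ} (hj : 1 ≤ j) : ρ (j + 1) < ρ j := by
  obtain ⟨c, hc, hs⟩ := h.step
  have := hs j hj
  have : 0 < c * r / kappa k N j :=
    div_pos (mul_pos hc hr) (by linarith [one_le_kappa hk hN hj])
  linarith

theorem IsAdaptedRadii.half_le {k : ℕ} {N r : ℝ} {ρ : ℕ → ℝ} (h : IsAdaptedRadii k N r ρ)
    (hk : 1 ≤ k) (hN : 1 < N) (hr : 0 < r) {j : ℕ} (hj : 1 ≤ j) : r / 2 ≤ ρ j := by
  have hanti : Antitone fun i => ρ (i + 1) :=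
    antitone_nat_of_succ_le fun i => (h.lt hk hN hr (by omega)).le
  obtain ⟨i, rfl⟩ := Nat.exists_eq_add_of_le' hj
  exact hanti.le_of_tendsto (h.limit.comp (tendsto_add_atTop_nat 1)) i

theorem IsAdaptedRadii.le {k : ℕ} {N r : ℝ} {ρ : ℕ → ℝ} (h : IsAdaptedRadii k N r ρ)
    (hk : 1 ≤ k) (hN : 1 < N) (hr : 0 < r) {j : ℕ} (hj : 1 ≤ j) : ρ j ≤ r := by
  induction j, hj using Nat.le_induction with
  | base => exact h.first.le
  | succ j hj ih => exact (h.lt hk hN hr hj).le.trans ih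

/-- The existence of adapted radii forces `∑ 1 / κ_{k,N}(j) < ∞`. -/
theorem IsAdaptedRadii.summable {k : ℕ} {N r : ℝ} {ρ : ℕ → ℝ} (h : IsAdaptedRadii k N r ρ)
    (hk : 1 ≤ k) (hN : 1 < N) (hr : 0 < r) : Summable fun i => 1 / kappa k N (i + 1) := by
  obtain ⟨c, hc, hs⟩ := h.step
  have hκ : ∀ i, 0 < kappa k N (i + 1) := fun i =>
    zero_lt_one.trans_le (one_le_kappa hk hN (by omega))
  refine summable_of_sum_range_le (c := 1 / (2 * c)) (fun i => (by have := hκ i; positivity))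
    fun m => ?_
  have h1 : c * r * ∑ i ∈ Finset.range m, 1 / kappa k N (i + 1) = ρ 1 - ρ (m + 1) := by
    rw [Finset.mul_sum]
    have := Finset.sum_range_sub' (fun i => ρ (i + 1)) m
    rw [← this]
    refine Finset.sum_congr rfl fun i _ => ?_
    rw [hs (i + 1) (by omega)]; ring
  have h2 := h.half_le hk hN hr (j := m + 1) (by omega)
  rw [h.first] at h1
  rw [le_div_iff₀ (by positivity)]
  nlinarith

theorem deGiorgi_step {A S : Eucl n → Matrix (Fin n) (Fin n) ℝ} {Ω U B D D' : Set (Eucl n)}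
    {w : Eucl n → ℝ≥0} {c₀ C₀ : ℝ} (hc₀ : 0 < c₀) (hC₀ : 0 < C₀) (hΩ : IsOpen Ω)
    (hw : Measurable w) (hA : IsCoefficient Ω w A S c₀ C₀)
    {f u : Eucl n → ℝ} {Gu : Eucl n → Eucl n} (hu : MemWA A Ω u Gu)
    (hsub : ∀ (g : Eucl n → ℝ) (Gg : Eucl n → Eucl n), MemWAZero A Ω g Gg →
      (∀ᵐ x ∂volume.restrict Ω, 0 ≤ g x) → IntegrableOn (fun x => f x * g x) Ω →
      ∫ x in Ω, f x * g x ≤ -∫ x in Ω, inner ℝ (Gg x) (mulE (A x) (Gu x)))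
    (hD' : NullMeasurableSet D' volume) (hDD : D' ⊆ D) (hDB : D ⊆ B) (hBU : B ⊆ U) (hUΩ : U ⊆ Ω)
    (hf : IsAdmissibleOn w A S B f) {k : ℕ} {N CS ρ W : ℝ} {φ : ℝ → ℝ} (hN : 1 < N)
    (hOS : OrliczSobolevOn (youngPhi k N) w S U CS φ ρ) (hφ : 0 < CS * φ ρ) (hW : 0 < W)
    (hWU : wMeasure w U = ENNReal.ofReal W)
    {ψ : Eucl n → ℝ} (hψ : LipC D ψ) (hψ1 : ∀ y ∈ D', ψ y = 1) {K : ℝ} (hK : 0 ≤ K)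
    (hψK : ∀ᵐ y ∂volume.restrict Ω, ‖mulE (S y) (gradient ψ y)‖ ≤ K * √(w y))
    {C C' z e a s : ℝ} (hCC : C < C') (hC' : ∀ᵐ x ∂volume.restrict Ω, u x ≠ C') (hz0 : 0 ≤ z)
    (hz : ∫⁻ x in D, ENNReal.ofReal (max (u x - C) 0 ^ 2) ∂wMeasure w ≤ ENNReal.ofReal z)
    (he : 26 * C₀ * (K ^ 2 / c₀ * z) +
      16 * C₀ ^ 2 * (xNorm w A S B f).toReal ^ 2 * (z / (C' - C) ^ 2) ≤ e)
    (ha : 0 < a) (hea : (CS * φ ρ) ^ 2 * (2 * e) < a ^ 2 * W) (hs : threshold k N ≤ s) :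
    ∫⁻ x in D', ENNReal.ofReal (max (u x - C') 0 ^ 2) ∂wMeasure w ≤
      ENNReal.ofReal (a ^ 2 * (s * (z / (C' - C) ^ 2) + W / logFactor k N s)) := by
  have hδ : 0 < C' - C := sub_pos.2 hCC
  set m := z / (C' - C) ^ 2 with hm
  have hm0 : 0 ≤ m := by positivity
  have hDΩ : D ⊆ Ω := hDB.trans (hBU.trans hUΩ)
  obtain ⟨vj, -, hlim, -⟩ := hu.exists_approx hΩ
  have huD : AEMeasurable u (volume.restrict D) :=
    (hlim.meas.mono_measure (Measure.restrict_mono_set _ hDΩ)).aemeasurable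
  have huD' : AEMeasurable u ((wMeasure w).restrict D) :=
    huD.mono_ac (restrict_wMeasure_absolutelyContinuous w D)
  obtain ⟨L, hL⟩ := hψ.1
  -- The given cutoffs need not take values in `[0, 1]`; clamping preserves the support, the value
  -- `1` on `D'` and the gradient bound.
  set η : Eucl n → ℝ := fun y => max (min (ψ y) 1) 0 with hη
  have hηL : LipC D η := hψ.clamp
  have hη0 : ∀ y, 0 ≤ η y := fun y => le_max_right _ _
  have hη1 : ∀ y, η y ≤ 1 := fun y => max_le (min_le_right _ _) zero_le_one
  have hηD : ∀ y, η y ≠ 0 → y ∈ D := fun y hy => hηL.2.2 (subset_tsupport η hy)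
  have hηK : ∀ᵐ y ∂volume.restrict Ω, ‖mulE (S y) (gradient η y)‖ ≤ K * √(w y) := by
    filter_upwards [hψK] with y hy
    rcases gradient_clamp (v := ψ) hL.continuous.continuousAt (x := y) with h | h
    · rw [hη, h]; exact hy
    · rw [hη, h]
      have : mulE (S y) (0 : Eucl n) = 0 := by simp [mulE]
      rw [this, norm_zero]; positivity
  -- the measure of the support
  have hmeas : wMeasure w {y | η y ≠ 0 ∧ C' < u y} ≤ ENNReal.ofReal m := by
    have h1 := mul_meas_ge_le_lintegral₀
      (((huD'.sub_const C).max aemeasurable_const).pow_const 2).ennreal_ofReal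
      (ENNReal.ofReal ((C' - C) ^ 2)) (μ := (wMeasure w).restrict D) (f := fun x =>
        ENNReal.ofReal (max (u x - C) 0 ^ 2))
    have h2 : wMeasure w {y | η y ≠ 0 ∧ C' < u y} ≤ (wMeasure w).restrict D
        {x | ENNReal.ofReal ((C' - C) ^ 2) ≤ ENNReal.ofReal (max (u x - C) 0 ^ 2)} := by
      refine le_trans (measure_mono fun y hy => ?_) (Measure.le_restrict_apply _ _)
      refine ⟨ENNReal.ofReal_le_ofReal (pow_le_pow_left₀ hδ.le ?_ 2), hηD y hy.1⟩
      exact le_max_of_le_left (by linarith [hy.2])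
    rw [hm, ENNReal.ofReal_div_of_pos (by positivity), ENNReal.le_div_iff_mul_le
      (Or.inl (by simpa using hδ.ne')) (Or.inl ENNReal.ofReal_ne_top), mul_comm]
    exact (mul_le_mul_right h2 _).trans (h1.trans hz)
  -- the energy of the cutoff
  have hJ : ∫⁻ x in Ω, ENNReal.ofReal (max (u x - C') 0 ^ 2 * quad (A x) (gradient η x)) ≤
      ENNReal.ofReal (K ^ 2 / c₀ * z) := by
    have hind : ∀ x, ENNReal.ofReal (max (u x - C') 0 ^ 2 * quad (A x) (gradient η x)) =
        D.indicator (fun x =>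
          ENNReal.ofReal (max (u x - C') 0 ^ 2 * quad (A x) (gradient η x))) x := by
      intro x
      by_cases hx : x ∈ D
      · rw [Set.indicator_of_mem hx]
      · rw [Set.indicator_of_notMem hx,
          gradient_eq_zero_of_notMem_tsupport fun h => hx (hηL.2.2 h), quad_zero]
        simp
    calc ∫⁻ x in Ω, ENNReal.ofReal (max (u x - C') 0 ^ 2 * quad (A x) (gradient η x))
        ≤ ∫⁻ x in D, ENNReal.ofReal (max (u x - C') 0 ^ 2 * quad (A x) (gradient η x)) := by
          rw [lintegral_congr hind, ← Measure.restrict_restrict_of_subset hDΩ]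
          exact lintegral_indicator_le _ _
      _ ≤ ∫⁻ x in D, ENNReal.ofReal (K ^ 2 / c₀) *
            (w x * ENNReal.ofReal (max (u x - C) 0 ^ 2)) := by
          have hres : volume.restrict D ≤ volume.restrict Ω := Measure.restrict_mono_set _ hDΩ
          refine lintegral_mono_ae ?_
          filter_upwards [ae_mono hres hηK, ae_mono hres hA.lower, ae_mono hres hA.posSemidef]
            with x h1 h2 h3
          rw [← ENNReal.ofReal_coe_nnreal, ← ENNReal.ofReal_mul (by positivity),
            ← ENNReal.ofReal_mul (by positivity)]
          refine ENNReal.ofReal_le_ofReal ?_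
          have h4 : quad (A x) (gradient η x) ≤ K ^ 2 / c₀ * w x := by
            rw [div_mul_eq_mul_div, le_div_iff₀ hc₀, mul_comm]
            refine (h2 _).trans ((pow_le_pow_left₀ (norm_nonneg _) h1 2).trans (le_of_eq ?_))
            rw [mul_pow, Real.sq_sqrt (NNReal.coe_nonneg _)]
          have h5 : max (u x - C') 0 ^ 2 ≤ max (u x - C) 0 ^ 2 :=
            pow_le_pow_left₀ (le_max_right _ _) (max_le_max (by linarith) le_rfl) 2
          calc _ ≤ max (u x - C) 0 ^ 2 * (K ^ 2 / c₀ * w x) :=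
                mul_le_mul h5 h4 (quad_nonneg h3 _) (sq_nonneg _)
            _ = _ := by ring
      _ = ENNReal.ofReal (K ^ 2 / c₀) *
            ∫⁻ x in D, ENNReal.ofReal (max (u x - C) 0 ^ 2) ∂wMeasure w := by
          rw [lintegral_const_mul' _ _ ENNReal.ofReal_ne_top, wMeasure, restrict_withDensity',
            lintegral_withDensity_eq_lintegral_mul₀ hw.coe_nnreal_ennreal.aemeasurable
              (((huD.sub_const C).max aemeasurable_const).pow_const 2).ennreal_ofReal]
          rfl
      _ ≤ _ := by
          rw [ENNReal.ofReal_mul (by positivity)]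
          exact mul_le_mul_right hz _
  have hcac := caccioppoli hC₀ hΩ hA hu hsub (hBU.trans hUΩ) hf (hηL.mono hDB) hη0 hη1 hC' hm0
    hmeas (by positivity) hJ
  have he0 : 0 ≤ e := le_trans (by positivity) he
  have hmem := memWAZero_mul_posPart hΩ hA hu (hDB.trans hBU) hUΩ hηL hC'
  have hfin := lintegral_sq_le_of_orliczSobolev hΩ hA hUΩ hN hOS hφ hW hWU he0 ha hea hs hm0 hmem
    (le_trans (measure_mono fun y hy => ?_) hmeas)
    ((lintegral_mono_set hUΩ).trans (hcac.trans (ENNReal.ofReal_le_ofReal he)))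
  · refine le_trans ?_ hfin
    refine le_trans ?_ (lintegral_mono_set (hDD.trans (hDB.trans hBU)))
    refine lintegral_mono_ae ?_
    filter_upwards [ae_restrict_mem₀ (hD'.mono_ac (withDensity_absolutelyContinuous _ _))]
      with y hy
    have : η y = 1 := by simp [hη, hψ1 y hy]
    rw [this, one_mul]
  · refine ⟨fun h0 => hy.2 (by simp [h0]), ?_⟩
    by_contra hlt
    refine hy.2 ?_
    rw [max_eq_right (by linarith [not_lt.1 hlt]), mul_zero]

/-- The number `σ = 1 + ∑ 1 / κ_{k,N}(j)`. -/
def kappaSum (k : ℕ) (N : ℝ) : ℝ := 1 + ∑' i, 1 / kappa k N (i + 1)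

/-- The levels increasing from `0` to at most `1` with increments `1 / (σ κ_{k,N}(i + 1))`. -/
def level (k : ℕ) (N : ℝ) (i : ℕ) : ℝ :=
  (∑ l ∈ Finset.range i, 1 / kappa k N (l + 1)) / kappaSum k N

/-- No summability is needed, as a divergent `tsum` is `0`; hence the constants of the theorem can
be fixed before any radii are given. -/
theorem kappaSum_pos {k : ℕ} {N : ℝ} (hk : 1 ≤ k) (hN : 1 < N) : 0 < kappaSum k N := by
  have : 0 ≤ ∑' i, 1 / kappa k N (i + 1) := tsum_nonneg fun i => by
    have := one_le_kappa hk hN (j := i + 1) (by omega)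
    positivity
  unfold kappaSum
  linarith

theorem level_succ (k : ℕ) (N : ℝ) (i : ℕ) :
    level k N (i + 1) - level k N i = 1 / (kappaSum k N * kappa k N (i + 1)) := by
  rw [level, level, Finset.sum_range_succ, ← sub_div, add_sub_cancel_left, div_div, mul_comm]

theorem level_le_one {k : ℕ} {N : ℝ} (hk : 1 ≤ k) (hN : 1 < N)
    (hs : Summable fun i => 1 / kappa k N (i + 1)) (i : ℕ) : level k N i ≤ 1 := by
  rw [level, div_le_one (kappaSum_pos hk hN), kappaSum]
  have := hs.sum_le_tsum (Finset.range i) fun l _ => by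
    have := one_le_kappa hk hN (j := l + 1) (by omega)
    positivity
  linarith

theorem level_succ_pos {k : ℕ} {N : ℝ} (hk : 1 ≤ k) (hN : 1 < N) (i : ℕ) :
    0 < level k N (i + 1) := by
  refine div_pos (Finset.sum_pos (fun l _ => ?_) (by simp)) (kappaSum_pos hk hN)
  have := one_le_kappa hk hN (j := l + 1) (by omega)
  positivity

/-- The constant in one step of the iteration. -/
def stepConstant (k : ℕ) (N c₀ C₀ CS K R : ℝ) : ℝ :=
  27 * CS ^ 2 * (26 * C₀ * K ^ 2 / c₀ + 16 * C₀ ^ 2 * kappaSum k N ^ 2 * R ^ 2 / 9)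

/-- Induction on the step with the ansatz `z_i ≤ T² W e^{-4(L+i+1)}`; since the levels stay below
`1`, these bounds force `(u - T)₊` to vanish on the half ball. -/
theorem ae_le_of_iteration {A S : Eucl n → Matrix (Fin n) (Fin n) ℝ} {Ω : Set (Eucl n)}
    {d : Eucl n → Eucl n → ℝ} {x : Eucl n}
    {w : Eucl n → ℝ≥0} {c₀ C₀ : ℝ} (hc₀ : 0 < c₀) (hC₀ : 0 < C₀) (hΩ : IsOpen Ω)
    (hball : ∀ ρ : ℝ, 0 < ρ → NullMeasurableSet (dball d Ω x ρ) volume)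
    (hw : Measurable w) (hA : IsCoefficient Ω w A S c₀ C₀)
    {f u : Eucl n → ℝ} {Gu : Eucl n → Eucl n} (hu : MemWA A Ω u Gu)
    (hsub : ∀ (g : Eucl n → ℝ) (Gg : Eucl n → Eucl n), MemWAZero A Ω g Gg →
      (∀ᵐ x ∂volume.restrict Ω, 0 ≤ g x) → IntegrableOn (fun x => f x * g x) Ω →
      ∫ x in Ω, f x * g x ≤ -∫ x in Ω, inner ℝ (Gg x) (mulE (A x) (Gu x)))
    {k : ℕ} {N CS K R r F L T W : ℝ} {φ : ℝ → ℝ} (hk : 1 ≤ k) (hN : 1 < N) (hCS : 0 < CS)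
    (hK : 0 < K) (hr : 0 < r) (hrR : 3 * r ≤ R) (hF : φ (3 * r) = 3 * r * F) (hF1 : 1 ≤ F)
    (hf : IsAdmissibleOn w A S (dball d Ω x r) f)
    (hOS : OrliczSobolevOn (youngPhi k N) w S (dball d Ω x (3 * r)) CS φ (3 * r)) (hW : 0 < W)
    (hWU : wMeasure w (dball d Ω x (3 * r)) = ENNReal.ofReal W)
    (hcut : HasAdaptedCutoffs k N d Ω w S K x r)
    (hT : 0 < T) (hTX : (xNorm w A S (dball d Ω x r) f).toReal ≤ T)
    (hTlevel : ∀ i, ∀ᵐ y ∂volume.restrict Ω, u y ≠ level k N (i + 1) * T)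
    (hstart : ∫⁻ y in dball d Ω x r, ENNReal.ofReal (max (u y) 0 ^ 2) ∂wMeasure w ≤
      ENNReal.ofReal (T ^ 2 * W * Real.exp (-4 * (L + 1))))
    (hL : ∀ j : ℕ, 1 ≤ j → threshold k N ≤ Real.exp (L + j) ∧
      stepConstant k N c₀ C₀ CS K R * F ^ 2 * kappa k N j ^ 2 *
        (Real.exp (L + j) * (kappaSum k N ^ 2 * kappa k N j ^ 2 * Real.exp (-4 * (L + j))) +
          1 / logFactor k N (Real.exp (L + j))) ≤ Real.exp (-4)) :
    ∀ᵐ y ∂(wMeasure w).restrict (dball d Ω x (r / 2)), u y ≤ T := by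
  obtain ⟨ρ, ψ, hρ, hψ⟩ := hcut
  have hsum := hρ.summable hk hN hr
  set σ := kappaSum k N with hσdef
  have hσ : 0 < σ := kappaSum_pos hk hN
  set X := (xNorm w A S (dball d Ω x r) f).toReal with hX
  have hX0 : 0 ≤ X := ENNReal.toReal_nonneg
  have hmain : ∀ i : ℕ, ∫⁻ y in dball d Ω x (ρ (i + 1)),
      ENNReal.ofReal (max (u y - level k N i * T) 0 ^ 2) ∂wMeasure w ≤
        ENNReal.ofReal (T ^ 2 * W * Real.exp (-4 * (L + (i + 1 : ℕ)))) := by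
    intro i
    induction i with
    | zero => simpa [level, hρ.first] using hstart
    | succ i ih =>
      obtain ⟨hcLip, hcone, hcgrad⟩ := hψ (i + 1) (by omega)
      obtain ⟨hs, hstep⟩ := hL (i + 1) (by omega)
      have hκ1 := one_le_kappa hk hN (j := i + 1) (by omega)
      have hρr := hρ.le hk hN hr (j := i + 1) (by omega)
      have hρ' := hρ.lt hk hN hr (j := i + 1) (by omega)
      have hρhalf := hρ.half_le hk hN hr (j := i + 1 + 1) (by omega)
      have hh := logFactor_pos hN hs
      set b := L + ((i + 1 : ℕ) : ℝ) with hb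
      set κ := kappa k N (i + 1) with hκ
      set h := logFactor k N (Real.exp b)
      set z := T ^ 2 * W * Real.exp (-4 * b) with hz
      have hz0 : 0 < z := by positivity
      set B₀ := 26 * C₀ * K ^ 2 / c₀ + 16 * C₀ ^ 2 * σ ^ 2 * R ^ 2 / 9 with hB₀
      have hB₀pos : 0 < B₀ := by positivity
      have hφpos : 0 < CS * φ (3 * r) := by rw [hF]; positivity
      set e := B₀ * κ ^ 2 / r ^ 2 * z with he
      have he0 : 0 < e := by positivity
      -- Any constant above `2` would do in place of `3`; with `φ(3r) = 3rF` it produces the `27` in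
      -- `stepConstant`.
      set a := √(3 * (CS * φ (3 * r)) ^ 2 * e / W) with ha
      have ha0 : 0 < a := Real.sqrt_pos.2 (by positivity)
      have ha2 : a ^ 2 * W = 3 * (CS * φ (3 * r)) ^ 2 * e := by
        rw [ha, Real.sq_sqrt (by positivity), div_mul_cancel₀ _ hW.ne']
      have hgap : level k N (i + 1) * T - level k N i * T = T / (σ * κ) := by
        rw [← sub_mul, level_succ]; ring
      have hgap0 : 0 < T / (σ * κ) := by positivity
      have hm : z / (T / (σ * κ)) ^ 2 = σ ^ 2 * κ ^ 2 * (W * Real.exp (-4 * b)) := by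
        rw [hz]; field_simp
      -- Gives the source term of the Caccioppoli inequality the same `1 / r²` scaling as the cutoff
      -- term, which is where `R` enters the constants.
      have hR : 1 ≤ R ^ 2 / (9 * r ^ 2) := by
        rw [le_div_iff₀ (by positivity)]; nlinarith
      have hstep' := deGiorgi_step hc₀ hC₀ hΩ hw hA hu hsub
        (hball (ρ (i + 1 + 1)) (by linarith)) (dball_mono hρ'.le) (dball_mono hρr)
        (dball_mono (by linarith)) (dball_subset d Ω x (3 * r)) hf hN hOS hφpos hW hWU hcLip hcone
        (K := K * (κ / r)) (by positivity) hcgrad (C := level k N i * T)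
        (C' := level k N (i + 1) * T) (z := z) (e := e) (a := a) (s := Real.exp b)
        (by linarith) (hTlevel i) hz0.le ih ?_ ha0 ?_ hs
      · refine hstep'.trans (ENNReal.ofReal_le_ofReal ?_)
        rw [hgap, hm]
        have e1 : Real.exp (-4 * (L + ((i + 1 + 1 : ℕ) : ℝ))) =
            Real.exp (-4 * b) * Real.exp (-4) := by
          rw [← Real.exp_add, hb]; push_cast; ring_nf
        rw [e1]
        have e2 : a ^ 2 * (Real.exp b * (σ ^ 2 * κ ^ 2 * (W * Real.exp (-4 * b))) + W / h) =
            z * (stepConstant k N c₀ C₀ CS K R * F ^ 2 * κ ^ 2 *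
              (Real.exp b * (σ ^ 2 * κ ^ 2 * Real.exp (-4 * b)) + 1 / h)) := by
          calc _ = (a ^ 2 * W) *
                (Real.exp b * (σ ^ 2 * κ ^ 2 * Real.exp (-4 * b)) + 1 / h) := by ring
            _ = _ := by
              rw [ha2, hF, he, stepConstant, ← hB₀]
              field_simp
              ring
        rw [e2]
        calc _ ≤ z * Real.exp (-4) := mul_le_mul_of_nonneg_left hstep hz0.le
          _ = _ := by rw [hz]; ring
      · rw [hgap, hm]
        have h1 : X ^ 2 * (σ ^ 2 * κ ^ 2 * (W * Real.exp (-4 * b))) ≤ σ ^ 2 * κ ^ 2 * z := by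
          calc _ ≤ T ^ 2 * (σ ^ 2 * κ ^ 2 * (W * Real.exp (-4 * b))) := by gcongr
            _ = _ := by rw [hz]; ring
        have h2 : σ ^ 2 * κ ^ 2 * z ≤ σ ^ 2 * κ ^ 2 * z * (R ^ 2 / (9 * r ^ 2)) :=
          le_mul_of_one_le_right (by positivity) hR
        calc _ = 26 * C₀ * ((K * (κ / r)) ^ 2 / c₀ * z) +
              16 * C₀ ^ 2 * (X ^ 2 * (σ ^ 2 * κ ^ 2 * (W * Real.exp (-4 * b)))) := by ring
          _ ≤ 26 * C₀ * ((K * (κ / r)) ^ 2 / c₀ * z) +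
              16 * C₀ ^ 2 * (σ ^ 2 * κ ^ 2 * z * (R ^ 2 / (9 * r ^ 2))) :=
              add_le_add le_rfl (mul_le_mul_of_nonneg_left (h1.trans h2) (by positivity))
          _ = e := by rw [he, hB₀]; field_simp
      · rw [ha2]
        have : 0 < (CS * φ (3 * r)) ^ 2 * e := by positivity
        linarith
  have hzero : ∫⁻ y in dball d Ω x (r / 2),
      ENNReal.ofReal (max (u y - T) 0 ^ 2) ∂wMeasure w = 0 := by
    have hlim : Tendsto (fun i : ℕ =>
        ENNReal.ofReal (T ^ 2 * W * Real.exp (-4 * (L + (i + 1 : ℕ))))) atTop (𝓝 0) := by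
      have h1 : Tendsto (fun i : ℕ => -4 * (L + ((i + 1 : ℕ) : ℝ))) atTop atBot :=
        (tendsto_atTop_add_const_left _ L ((tendsto_natCast_atTop_atTop).comp
          (tendsto_add_atTop_nat 1))).const_mul_atTop_of_neg (by norm_num)
      have h2 := (Real.tendsto_exp_atBot.comp h1).const_mul (T ^ 2 * W)
      rw [mul_zero] at h2
      simpa [Function.comp_def] using ENNReal.tendsto_ofReal h2
    refine le_antisymm (ge_of_tendsto' hlim fun i => ?_) zero_le
    refine le_trans ?_ (hmain i)
    refine (lintegral_mono_set (dball_mono (hρ.half_le hk hN hr (by omega)))).trans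
      (lintegral_mono fun y => ENNReal.ofReal_le_ofReal ?_)
    refine pow_le_pow_left₀ (le_max_right _ _) (max_le_max ?_ le_rfl) 2
    have := mul_le_of_le_one_left hT.le (level_le_one hk hN hsum i)
    linarith
  obtain ⟨vj, -, hlim, -⟩ := hu.exists_approx hΩ
  have hum : AEMeasurable u ((wMeasure w).restrict (dball d Ω x (r / 2))) :=
    (hlim.meas.mono_measure
      (Measure.restrict_mono_set _ (dball_subset d Ω x (r / 2)))).aemeasurable.mono_ac
      (restrict_wMeasure_absolutelyContinuous w _)
  rw [lintegral_eq_zero_iff'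
    (((hum.sub_const T).max aemeasurable_const).pow_const 2).ennreal_ofReal] at hzero
  filter_upwards [hzero] with y hy
  by_contra hlt
  have h1 : 0 < max (u y - T) 0 ^ 2 :=
    pow_pos (lt_max_of_lt_left (by linarith [not_le.1 hlt])) 2
  simp only [Pi.zero_apply, ENNReal.ofReal_eq_zero] at hy
  linarith

end Iteration

end DegEll

end

/-! ### Choice of the level and conclusion -/

theorem mainTheorem4 (k : ℕ) (hk : 1 ≤ k) (N : ℝ) (hN : 1 < N)
    (c₀ C₀ CS K R : ℝ) (hc₀ : 0 < c₀) (hC₀ : 0 < C₀) (hCS : 0 < CS) (hK : 0 < K) (hR : 0 < R) :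
    ∃ C₁ : ℝ, 0 < C₁ ∧ ∃ C₂ : ℝ, 0 < C₂ ∧
      ∀ (n : ℕ) (Ω : Set (Eucl n)) (d : Eucl n → Eucl n → ℝ) (w : Eucl n → ℝ≥0)
        (A S : Eucl n → Matrix (Fin n) (Fin n) ℝ) (φ : ℝ → ℝ) (f u : Eucl n → ℝ),
        IsOpen Ω → Bornology.IsBounded Ω →
        IsMetricOn d Ω →
        (∀ x ∈ Ω, ∀ ρ : ℝ, 0 < ρ → NullMeasurableSet (dball d Ω x ρ) volume) →
        Measurable w →
        IsCoefficient Ω w A S c₀ C₀ →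
        IsSuperradius φ R →
        AEStronglyMeasurable f (volume.restrict Ω) →
        IsWeakSubsolution A Ω f u →
        ∀ x ∈ Ω, ∀ r : ℝ, 0 < r → 3 * r ≤ R →
          wMeasure w (dball d Ω x (3 * r)) < ∞ →
          OrliczSobolevOn (youngPhi k N) w S (dball d Ω x (3 * r)) CS φ (3 * r) →
          HasAdaptedCutoffs k N d Ω w S K x r →
          IsAdmissibleOn w A S (dball d Ω x r) f →
          eLpNorm (fun y => max (u y) 0) ∞ ((wMeasure w).restrict (dball d Ω x (r / 2))) ≤
            ENNReal.ofReal (growthFactor k N C₁ C₂ φ (3 * r)) *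
                ((∫⁻ y in dball d Ω x r, ENNReal.ofReal (max (u y) 0 ^ 2) ∂wMeasure w) /
                  wMeasure w (dball d Ω x (3 * r))) ^ (1 / 2 : ℝ) +
              xNorm w A S (dball d Ω x r) f := by
  have hB : 0 < stepConstant k N c₀ C₀ CS K R := by
    have := kappaSum_pos hk hN
    unfold stepConstant
    positivity
  obtain ⟨C₂, hC₂, hiter⟩ := exists_iteration_constant hk hN hB (pow_pos (kappaSum_pos hk hN) 2)
  -- `C₁² = e⁴` pays for the `1` in `e^{4(L+1)}`, since the iteration starts at `j = 1`.
  refine ⟨Real.exp 2, Real.exp_pos 2, C₂, hC₂, ?_⟩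
  intro n Ω d w A S φ f u hΩ _ _ hball hw hA hφ _ hu x hx r hr hrR hWtop hOS hcut hf
  obtain ⟨Gu, hmem, hsub⟩ := hu
  have h3r : 0 < 3 * r := by positivity
  set B := dball d Ω x r with hBdef
  set U := dball d Ω x (3 * r) with hUdef
  have hBU : B ⊆ U := dball_mono (by linarith)
  have hhalfB : dball d Ω x (r / 2) ⊆ B := dball_mono (by linarith)
  rcases eq_or_ne (wMeasure w U) 0 with hU0 | hU0
  · have h0 : (wMeasure w).restrict (dball d Ω x (r / 2)) = 0 :=
      Measure.restrict_eq_zero.2 (measure_mono_null (hhalfB.trans hBU) hU0)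
    rw [h0, eLpNorm_measure_zero]
    exact zero_le
  set W := (wMeasure w U).toReal with hWdef
  have hW : 0 < W := ENNReal.toReal_pos hU0 hWtop.ne
  have hWU : wMeasure w U = ENNReal.ofReal W := (ENNReal.ofReal_toReal hWtop.ne).symm
  set F := φ (3 * r) / (3 * r) with hFdef
  have hF1 : 1 ≤ F := (one_le_div h3r).2 (hφ.ge _ ⟨h3r.le, hrR⟩)
  have hF : φ (3 * r) = 3 * r * F := (mul_div_cancel₀ _ h3r.ne').symm
  obtain ⟨L, hLle, hL⟩ := hiter F hF1
  set Γ := growthFactor k N (Real.exp 2) C₂ φ (3 * r) with hΓdef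
  have hΓ : Real.exp (4 * (L + 1)) ≤ Γ ^ 2 := by
    rw [hΓdef, growthFactor, ← Real.sqrt_eq_rpow, ← hFdef]
    obtain ⟨p, rfl⟩ := Nat.exists_eq_add_of_le' hk
    rw [Function.iterate_succ_apply', mul_pow, Real.sq_sqrt (Real.exp_pos _).le,
      ← Real.exp_nat_mul, ← Real.exp_add]
    refine Real.exp_le_exp.2 ?_
    rw [Nat.add_sub_cancel] at hLle
    push_cast
    linarith
  have hΓ0 : 0 < Γ := by
    rw [hΓdef, growthFactor, ← Real.sqrt_eq_rpow]
    obtain ⟨p, rfl⟩ := Nat.exists_eq_add_of_le' hk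
    rw [Function.iterate_succ_apply']
    positivity
  rcases eq_or_ne (∫⁻ y in B, ENNReal.ofReal (max (u y) 0 ^ 2) ∂wMeasure w) ∞ with hP | hP
  · rw [hP, ENNReal.top_div_of_ne_top hWtop.ne, ENNReal.top_rpow_of_pos (by norm_num),
      ENNReal.mul_top (by simpa using hΓ0), top_add]
    exact le_top
  set P := (∫⁻ y in B, ENNReal.ofReal (max (u y) 0 ^ 2) ∂wMeasure w).toReal with hPdef
  have hPeq := (ENNReal.ofReal_toReal hP).symm
  rw [← hPdef] at hPeq
  have hP0 : 0 ≤ P := ENNReal.toReal_nonneg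
  set X := (xNorm w A S B f).toReal with hXdef
  have hX0 : 0 ≤ X := ENNReal.toReal_nonneg
  have hXeq : xNorm w A S B f = ENNReal.ofReal X := (ENNReal.ofReal_toReal hf.2.ne).symm
  have hrhs : ENNReal.ofReal Γ * (ENNReal.ofReal P / ENNReal.ofReal W) ^ (1 / 2 : ℝ) +
      ENNReal.ofReal X = ENNReal.ofReal (Γ * √(P / W) + X) := by
    rw [← ENNReal.ofReal_div_of_pos hW, ENNReal.ofReal_rpow_of_nonneg (by positivity)
      (by norm_num), ← Real.sqrt_eq_rpow, ← ENNReal.ofReal_mul hΓ0.le,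
      ← ENNReal.ofReal_add (by positivity) hX0]
  rw [hPeq, hWU, hXeq, hrhs]
  set T₀ := Γ * √(P / W) + X with hT₀
  have hT₀0 : 0 ≤ T₀ := by positivity
  obtain ⟨vj, -, hlim, -⟩ := hmem.exists_approx hΩ
  refine ENNReal.le_of_forall_pos_le_add fun ε hε _ => ?_
  -- `T` lies strictly above `T₀` both to be positive and to make all level sets null; the excess
  -- `ε` is arbitrary.
  obtain ⟨T, hT0, hT1, hTlevel⟩ := exists_null_level_sets hlim.meas.aemeasurable
    (fun i => (level_succ_pos hk hN i).ne') (show T₀ < T₀ + ε from lt_add_of_pos_right _ hε)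
  have hT : 0 < T := hT₀0.trans_lt hT0
  have hsq : √(P / W) * Γ ≤ T := by linarith
  have hstart : P ≤ T ^ 2 * W * Real.exp (-4 * (L + 1)) := by
    have h1 : (√(P / W) * Γ) ^ 2 ≤ T ^ 2 := by gcongr
    rw [mul_pow, Real.sq_sqrt (by positivity)] at h1
    have h2 : P / W * Real.exp (4 * (L + 1)) ≤ T ^ 2 :=
      (mul_le_mul_of_nonneg_left hΓ (by positivity)).trans h1
    calc P = P / W * Real.exp (4 * (L + 1)) * W * Real.exp (-4 * (L + 1)) := by
          rw [neg_mul, Real.exp_neg]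
          field_simp
      _ ≤ _ := by gcongr
  have hae := ae_le_of_iteration hc₀ hC₀ hΩ (hball x hx) hw hA hmem hsub hk hN hCS hK hr hrR hF
    hF1 hf hOS hW hWU hcut hT
    (by rw [← hXdef]; linarith [mul_nonneg hΓ0.le (Real.sqrt_nonneg (P / W))])
    hTlevel (hPeq.le.trans (ENNReal.ofReal_le_ofReal hstart)) hL
  rw [eLpNorm_exponent_top]
  calc eLpNormEssSup (fun y => max (u y) 0) ((wMeasure w).restrict (dball d Ω x (r / 2)))
      ≤ ENNReal.ofReal T := by
        refine eLpNormEssSup_le_of_ae_bound ?_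
        filter_upwards [hae] with y hy
        rw [Real.norm_of_nonneg (le_max_right _ _)]
        exact max_le hy hT.le
    _ ≤ ENNReal.ofReal (T₀ + ε) := ENNReal.ofReal_le_ofReal hT1.le
    _ ≤ ENNReal.ofReal T₀ + ENNReal.ofReal ε := ENNReal.ofReal_add_le
    _ = ENNReal.ofReal T₀ + ε := by rw [ENNReal.ofReal_coe_nnreal]
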